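/- Definitions. A plot of a diffeological space $X$ is a smooth map $p\colon U_p\to X$ from an open subset $U_p$ of some $\mathbb{R}^n$; morphisms $p\to q$ of plots are smooth maps $f\colon U_p\to U_q$ with $q\circ f=p$. A generating family of $X$ is a set $\mathcal{Q}$ of plots such that every plot of $X$ factors locally and smoothly through members of $\mathcal{Q}$. Its nebula is $\mathcal{N}(\mathcal{Q})=\coprod_{q\in\mathcal{Q}}U_q$ with the sum diffeology, with evaluation map $\mathrm{ev}\colon\mathcal{N}(\mathcal{Q})\to X$; put $\mathcal{N}(\mathcal{Q})_k=\{(x_0,\dots,x_k)\in\mathcal{N}(\mathcal{Q})^{k+1} : \mathrm{ev}(x_0)=\dots=\mathrm{ev}(x_k)\}$ and $\mathrm{ev}_k(x_0,\dots,x_k)=\mathrm{ev}(x_0)$. For a presheaf $F$ of abelian groups on the category of plots of $X$, let $\check{C}^k(\mathcal{Q},F)$ be the group of global sections of $\mathrm{ev}_k^*F$ (coherent families $\eta_p\in F(\mathrm{ev}_k\circ p)$, $p$ a plot of $\mathcal{N}(\mathcal{Q})_k$), with coboundary $\partial=\sum_{i}(-1)^i\widetilde{d}_i$, where $\widetilde{d}_i$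 is induced by dropping the $i$-th entry, and let $\check{H}^k(\mathcal{Q},F)$ be its cohomology. A generating family $\mathcal{R}$ refines $\mathcal{Q}$ if every $r\in\mathcal{R}$ factors as $r=q\circ f$ with $q\in\mathcal{Q}$ and $f$ smooth; $\check{H}^k(X,F)$ is the direct limit of the groups $\check{H}^k(\mathcal{Q},F)$ over all generating families ordered by refinement. For an abelian diffeological group $G$, $\check{H}^1(X,G)$ denotes $\check{H}^1(X,C^\infty(\cdot,G))$, where $C^\infty(\cdot,G)$ sends a plot $p$ to the group of smooth maps $U_p\to G$. A smooth map $\varphi\colon Y\to X$ induces $\varphi^*\colon\check{H}^1(X,G)\to\check{H}^1(Y,G)$. A principal $G$-bundle over $X$ is a diffeological space $P$ with a smooth right action of $G$ and quotient map $\pi\colon P\to X$ (a subduction whose fibres are the $G$-orbits) such that $P\times G\to P\times_XP$, $(p,g)\mapsto(p,p\cdot g)$, is a diffeomorphism. Isomorphisms of principal $G$-bundles over $X$ are $G$-equivariant diffeomorphisms commuting with the projections to $X$. Theorem. Let $G$ be an abelian diffeological group. There are bijections, one for each diffeological space $X$, $$\Psi_X\colon\{\text{principal }G\text{-bundles over }X\}/\text{isomorphism}\;\longrightarrow\;\check{H}^1(X,G),$$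 that are natural in $X$: for every smooth map $\varphi\colon Y\to X$ and every principal $G$-bundle $P$ over $X$, $\Psi_Y([\varphi^*P])=\varphi^*(\Psi_X([P]))$, where $\varphi^*P=P\times_XY$. -/

import Mathlib

open Diffeology TopologicalSpace Topology ContDiff CategoryTheory Opposite

universe u v w

noncomputable section

namespace DiffCech

/-! ### Basic constructions: subsets, products, sums -/

/-- The subset diffeology: the plots of a subset are the plots of the ambient space with values
in the subset. -/
instance instSubtype {X : Type u} [DiffeologicalSpace X] (s : X → Prop) :
    DiffeologicalSpace {x : X // s x} where
  plots n := {p | IsPlot (fun y => (p y : X))}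
  constant_plots x := isPlot_const (x := (x : X))
  plot_reparam hp hf := isPlot_reparam (p := fun y => (_ : X)) hp hf
  locality {n p} h := DiffeologicalSpace.locality (p := fun y => (p y : X)) h

/-- The product diffeology on a binary product. -/
instance instProd {X : Type u} {Y : Type v} [DiffeologicalSpace X] [DiffeologicalSpace Y] :
    DiffeologicalSpace (X × Y) where
  plots n := {p | IsPlot (fun y => (p y).1) ∧ IsPlot (fun y => (p y).2)}
  constant_plots x := ⟨isPlot_const, isPlot_const⟩
  plot_reparam hp hf := ⟨isPlot_reparam hp.1 hf, isPlot_reparam hp.2 hf⟩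
  locality {n p} h := by
    constructor
    · refine DiffeologicalSpace.locality (p := fun y => (p y).1) fun x => ?_
      obtain ⟨u, hu, hx, H⟩ := h x
      exact ⟨u, hu, hx, fun hf hf' => (H hf hf').1⟩
    · refine DiffeologicalSpace.locality (p := fun y => (p y).2) fun x => ?_
      obtain ⟨u, hu, hx, H⟩ := h x
      exact ⟨u, hu, hx, fun hf hf' => (H hf hf').2⟩

/-- The product diffeology on an arbitrary product. -/
instance instPi {ι : Type w} {Y : ι → Type v} [∀ i, DiffeologicalSpace (Y i)] :
    DiffeologicalSpace (∀ i, Y i) where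
  plots n := {p | ∀ i, IsPlot (fun y => p y i)}
  constant_plots x := fun i => isPlot_const
  plot_reparam hp hf := fun i => isPlot_reparam (hp i) hf
  locality {n p} h := fun i => by
    refine DiffeologicalSpace.locality (p := fun y => p y i) fun x => ?_
    obtain ⟨u, hu, hx, H⟩ := h x
    exact ⟨u, hu, hx, fun hf hf' => H hf hf' i⟩

/-- An ordinary smooth map on an open set, with values in an open set, is smooth for the subset
diffeologies. -/
theorem dSmooth_of_contDiffOn {n m : ℕ} {U : Set (EuclideanSpace ℝ (Fin n))}
    {V : Set (EuclideanSpace ℝ (Fin m))}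
    (f : EuclideanSpace ℝ (Fin n) → EuclideanSpace ℝ (Fin m)) (hf : ContDiffOn ℝ ∞ f U)
    (hUV : ∀ x ∈ U, f x ∈ V) :
    DSmooth (fun x : {x // x ∈ U} => (⟨f x, hUV x x.2⟩ : {x // x ∈ V})) := by
  intro k g hg
  have hg' : ContDiff ℝ ∞ (fun y => (g y : EuclideanSpace ℝ (Fin n))) := IsPlot.contDiff hg
  have h : IsPlot (f ∘ fun y => (g y : EuclideanSpace ℝ (Fin n))) :=
    ContDiff.isPlot (hf.comp_contDiff hg' fun y => (g y).2)
  exact h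

/-- The sum diffeology: the plots are the maps that locally are plots of a single summand. -/
instance instSigma {ι : Type w} {Y : ι → Type v} [∀ i, DiffeologicalSpace (Y i)] :
    DiffeologicalSpace (Σ i, Y i) :=
  .ofCorePlotsOn
  { isPlotOn := fun {n u} _ p => ∀ x ∈ u, ∃ V : Opens (EuclideanSpace ℝ (Fin n)), x ∈ V ∧
      ∃ (i : ι) (q : V → Y i), DSmooth q ∧ ∀ y : V, p y = ⟨i, q y⟩
    isPlotOn_congr := by
      have key : ∀ {n : ℕ} {u : Set (EuclideanSpace ℝ (Fin n))} (_ : IsOpen u)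
          {p q : EuclideanSpace ℝ (Fin n) → Σ i, Y i}, Set.EqOn p q u →
          (∀ x ∈ u, ∃ V : Opens (EuclideanSpace ℝ (Fin n)), x ∈ V ∧
            ∃ (i : ι) (q : V → Y i), DSmooth q ∧ ∀ y : V, p y = ⟨i, q y⟩) →
          (∀ x ∈ u, ∃ V : Opens (EuclideanSpace ℝ (Fin n)), x ∈ V ∧
            ∃ (i : ι) (r : V → Y i), DSmooth r ∧ ∀ y : V, q y = ⟨i, r y⟩) := by
        intro n u hu p q h hp x hx
        obtain ⟨V, hV, i, r, hr, H⟩ := hp x hx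
        refine ⟨V ⊓ ⟨u, hu⟩, ⟨hV, hx⟩, i, fun y => r ⟨y.1, y.2.1⟩,
          fun m g hg => hr m (fun z => ⟨(g z).1, (g z).2.1⟩) hg, fun y => ?_⟩
        rw [← h y.2.2]
        exact H ⟨y.1, y.2.1⟩
      intro n u hu p q h
      exact ⟨key hu h, key hu h.symm⟩
    isPlot_const := fun x y _ => ⟨⊤, trivial, x.1, fun _ => x.2, dSmooth_const, fun _ => rfl⟩
    isPlotOn_reparam := by
      intro n m u v hu hv p f h hp hf x hx
      obtain ⟨V, hV, i, r, hr, H⟩ := hp (f x) (h hx)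
      refine ⟨⟨v ∩ f ⁻¹' V, hf.continuousOn.isOpen_inter_preimage hv V.2⟩, ⟨hx, hV⟩, i,
        fun y => r ⟨f y, y.2.2⟩, ?_, fun y => H ⟨f y, y.2.2⟩⟩
      exact hr.comp (dSmooth_of_contDiffOn f (hf.mono Set.inter_subset_left) fun y hy => hy.2)
    locality := by
      intro n u hu p hp x hx
      obtain ⟨v, hv, hxv, H⟩ := hp x hx
      exact H x hxv }

/-- A diffeomorphism: a smooth map with a smooth two-sided inverse. -/
def IsDiffeomorphism {X : Type u} {Y : Type v} [DiffeologicalSpace X] [DiffeologicalSpace Y]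
    (f : X → Y) : Prop :=
  DSmooth f ∧ ∃ g : Y → X, DSmooth g ∧ Function.LeftInverse g f ∧ Function.RightInverse g f

/-! ### The category of plots -/

/-- A plot of `X`: a smooth map into `X` from an open subset of a Euclidean space (which carries
the subset diffeology, so its plots are the ordinary smooth maps into it). -/
structure Plot (X : Type u) [DiffeologicalSpace X] where
  /-- the dimension of the Euclidean space -/
  dim : ℕ
  /-- the domain -/
  dom : Opens (EuclideanSpace ℝ (Fin dim))
  /-- the map -/
  toFun : dom → X
  smooth : DSmooth toFun

namespace Plot

variable {X : Type u} [DiffeologicalSpace X]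

/-- A morphism of plots: a smooth map of the domains that makes the triangle over `X` commute. -/
@[ext]
structure Hom (p q : Plot X) where
  /-- the map of domains -/
  toFun : p.dom → q.dom
  smooth : DSmooth toFun
  comm : ∀ x, q.toFun (toFun x) = p.toFun x

/-- The category of plots of `X`. -/
instance : Category (Plot X) where
  Hom p q := Hom p q
  id p := ⟨id, dSmooth_id, fun _ => rfl⟩
  comp f g := ⟨g.toFun ∘ f.toFun, g.smooth.comp f.smooth,
    fun x => (g.comm (f.toFun x)).trans (f.comm x)⟩

/-- The restriction of a plot to an open subset of its domain. -/
def restrict (p : Plot X) (V : Opens (EuclideanSpace ℝ (Fin p.dim))) (hV : V ≤ p.dom) : Plot X where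
  dim := p.dim
  dom := V
  toFun x := p.toFun ⟨x, hV x.2⟩
  smooth n g hg := p.smooth n (fun z => ⟨(g z).1, hV (g z).2⟩) hg

/-- The composition of a plot of `Z` with a smooth map `a : Z → X`. -/
def map {Z : Type w} [DiffeologicalSpace Z] (a : Z → X) (ha : DSmooth a) (p : Plot Z) : Plot X where
  dim := p.dim
  dom := p.dom
  toFun := a ∘ p.toFun
  smooth := ha.comp p.smooth

end Plot

/-- A subduction: a smooth surjection along which every plot of the target lifts locally. -/
def IsSubduction {X : Type u} {Y : Type v} [DiffeologicalSpace X] [DiffeologicalSpace Y]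
    (f : X → Y) : Prop :=
  DSmooth f ∧ Function.Surjective f ∧
    ∀ (p : Plot Y) (x : p.dom), ∃ (V : Opens (EuclideanSpace ℝ (Fin p.dim))) (hV : V ≤ p.dom),
      x.1 ∈ V ∧ ∃ q : V → X, DSmooth q ∧ ∀ y : V, f (q y) = p.toFun ⟨y, hV y.2⟩

/-- Postcomposition with a smooth map, as a functor between categories of plots. -/
def plotFunctor {Z : Type w} {X : Type u} [DiffeologicalSpace Z] [DiffeologicalSpace X]
    (a : Z → X) (ha : DSmooth a) : Plot Z ⥤ Plot X where
  obj p := p.map a ha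
  map f := ⟨f.toFun, f.smooth, fun x => congrArg a (f.comm x)⟩

/-! ### Presheaves of abelian groups on the category of plots -/

/-- Presheaves of abelian groups over `X`: contravariant functors on the category of plots. -/
abbrev AbPresheaf (X : Type u) [DiffeologicalSpace X] := (Plot X)ᵒᵖ ⥤ AddCommGrpCat.{v}

/-- The pullback presheaf `a^*F`, with `(a^*F)(p) = F(a ∘ p)`. -/
def AbPresheaf.pullback {Z : Type w} {X : Type u} [DiffeologicalSpace Z] [DiffeologicalSpace X]
    (a : Z → X) (ha : DSmooth a) (F : AbPresheaf.{u, v} X) : AbPresheaf.{w, v} Z :=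
  (plotFunctor a ha).op ⋙ F

theorem AbPresheaf.map_map_op {X : Type u} [DiffeologicalSpace X] (F : AbPresheaf.{u, v} X)
    {p q r : Plot X} (f : p ⟶ q) (g : q ⟶ r) (x : F.obj (op r)) :
    F.map f.op (F.map g.op x) = F.map (f ≫ g).op x := by
  rw [op_comp, F.map_comp]
  rfl

/-- The group of global sections of a presheaf: coherent families `η p ∈ F p`, `p` a plot. -/
def globalSections {X : Type u} [DiffeologicalSpace X] (F : AbPresheaf.{u, v} X) :
    AddSubgroup (∀ p : Plot X, F.obj (op p)) where
  carrier := {η | ∀ (p q : Plot X) (f : p ⟶ q), F.map f.op (η q) = η p}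
  add_mem' {η μ} hη hμ p q f := by simp [hη p q f, hμ p q f]
  zero_mem' p q f := by simp
  neg_mem' {η} hη p q f := by simp [hη p q f]

section comap

variable {W Z X : Type*} [DiffeologicalSpace W] [DiffeologicalSpace Z] [DiffeologicalSpace X]

/-- If `a ∘ h = b`, then the plots `b ∘ p` and `a ∘ (h ∘ p)` are equal; this is the identity arrow
between them. -/
def Plot.eqHom (a : Z → X) (ha : DSmooth a) (b : W → X) (hb : DSmooth b) (h : W → Z)
    (hh : DSmooth h) (hab : ∀ x, a (h x) = b x) (p : Plot W) :
    p.map b hb ⟶ (p.map h hh).map a ha :=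
  Plot.Hom.mk id dSmooth_id fun x => hab (p.toFun x)

/-- The homomorphism `a^*F(Z) → h^*(a^*F)(W) = b^*F(W)` on global sections that is induced by a
smooth map `h : W → Z` with `a ∘ h = b`. It sends `η` to the family `p ↦ η (h ∘ p)`. -/
def comap (F : AbPresheaf.{_, v} X) (a : Z → X) (ha : DSmooth a) (b : W → X) (hb : DSmooth b)
    (h : W → Z) (hh : DSmooth h) (hab : ∀ x, a (h x) = b x) :
    globalSections (F.pullback a ha) →+ globalSections (F.pullback b hb) where
  toFun η := ⟨fun p => F.map (Plot.eqHom a ha b hb h hh hab p).op (η.1 (p.map h hh)), by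
    intro p q f
    have h1 := η.2 (p.map h hh) (q.map h hh) ((plotFunctor h hh).map f)
    refine Eq.trans ?_ (congrArg (F.map (Plot.eqHom a ha b hb h hh hab p).op) h1)
    exact (AbPresheaf.map_map_op F ((plotFunctor b hb).map f) (Plot.eqHom a ha b hb h hh hab q) _).trans
      (AbPresheaf.map_map_op F (Plot.eqHom a ha b hb h hh hab p)
        ((plotFunctor a ha).map ((plotFunctor h hh).map f)) _).symm⟩
  map_zero' := by
    ext p
    exact map_zero _
  map_add' η μ := by
    ext p
    exact map_add _ _ _

end comap


section comapLemmas

variable {V W Z X : Type*} [DiffeologicalSpace V] [DiffeologicalSpace W] [DiffeologicalSpace Z]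
  [DiffeologicalSpace X]

theorem comap_comap (F : AbPresheaf.{_, v} X) (a : Z → X) (ha : DSmooth a)
    (b : W → X) (hb : DSmooth b) (c : V → X) (hc : DSmooth c)
    (h : W → Z) (hh : DSmooth h) (hab : ∀ x, a (h x) = b x)
    (k : V → W) (hk : DSmooth k) (hbc : ∀ x, b (k x) = c x)
    (η : globalSections (F.pullback a ha)) :
    comap F b hb c hc k hk hbc (comap F a ha b hb h hh hab η) =
      comap F a ha c hc (h ∘ k) (hh.comp hk) (fun x => (hab _).trans (hbc x)) η := by
  ext p
  exact AbPresheaf.map_map_op F (Plot.eqHom b hb c hc k hk hbc p)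
    (Plot.eqHom a ha b hb h hh hab (p.map k hk)) (η.1 _)

theorem comap_id (F : AbPresheaf.{_, v} X) (a : Z → X) (ha : DSmooth a)
    (η : globalSections (F.pullback a ha)) :
    comap F a ha a ha id dSmooth_id (fun _ => rfl) η = η := by
  ext p
  exact congrArg (fun f => f (η.1 p)) (F.map_id (op (p.map a ha)))

end comapLemmas

/-! ### Generating families, nebulae, and the Čech complex -/

/-- A generating family of `X`: a set of plots such that every plot of `X` locally factors
smoothly through one of them. -/
@[ext]
structure GenFam (X : Type u) [DiffeologicalSpace X] where
  /-- the plots in the family -/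
  plots : Set (Plot X)
  generates : ∀ (p : Plot X) (x : p.dom),
    ∃ (V : Opens (EuclideanSpace ℝ (Fin p.dim))) (hV : V ≤ p.dom), x.1 ∈ V ∧
      ∃ q ∈ plots, Nonempty (p.restrict V hV ⟶ q)

section Nebula

variable {X : Type u} [DiffeologicalSpace X]

/-- The nebula of a generating family: the sum of the domains of its plots. -/
abbrev Nebula (Q : GenFam X) : Type u := Σ q : Q.plots, q.1.dom

/-- The evaluation map from the nebula to `X`. -/
def ev (Q : GenFam X) (x : Nebula Q) : X := x.1.1.toFun x.2

theorem dSmooth_ev (Q : GenFam X) : DSmooth (ev Q) := by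
  intro n p hp
  refine DiffeologicalSpace.locality fun x => ?_
  obtain ⟨V, hV, q, r, hr, H⟩ := hp x trivial
  refine ⟨V, V.2, hV, fun {m f} hfV hf => ?_⟩
  have h1 : DSmooth (fun y => q.1.toFun (r y)) := q.1.smooth.comp hr
  have h2 := h1 m (fun z => ⟨f z, hfV z⟩) hf.isPlot
  have h3 : (ev Q ∘ p) ∘ f = (fun y => q.1.toFun (r y)) ∘ fun z => ⟨f z, hfV z⟩ := by
    funext z
    change ev Q (p (f z)) = _
    rw [H ⟨f z, hfV z⟩]
    rfl
  rw [h3]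
  exact h2

/-- The fibre product `N(Q)_k` of `k + 1` copies of the nebula over `X`. -/
abbrev Nerve (Q : GenFam X) (k : ℕ) : Type u :=
  {x : Fin (k + 1) → Nebula Q // ∀ i j, ev Q (x i) = ev Q (x j)}

/-- The map `N(Q)_k → X`, `(x₀, …, x_k) ↦ ev x₀`. -/
def evk (Q : GenFam X) (k : ℕ) (x : Nerve Q k) : X := ev Q (x.1 0)

theorem dSmooth_evk (Q : GenFam X) (k : ℕ) : DSmooth (evk Q k) :=
  (dSmooth_ev Q).comp (fun _ _ hp => hp 0)

/-- The map `d_i : N(Q)_{k+1} → N(Q)_k` that drops the `i`-th entry. -/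
def face (Q : GenFam X) (k : ℕ) (i : Fin (k + 2)) (x : Nerve Q (k + 1)) : Nerve Q k :=
  ⟨fun j => x.1 (i.succAbove j), fun _ _ => x.2 _ _⟩

theorem dSmooth_face (Q : GenFam X) (k : ℕ) (i : Fin (k + 2)) : DSmooth (face Q k i) :=
  fun _ _ hp j => hp (i.succAbove j)

theorem evk_face (Q : GenFam X) (k : ℕ) (i : Fin (k + 2)) (x : Nerve Q (k + 1)) :
    evk Q k (face Q k i x) = evk Q (k + 1) x := x.2 _ _

/-- The group `C^k(Q, F)` of degree `k` cochains: global sections of `ev_k^* F` over `N(Q)_k`. -/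
abbrev Cochain (Q : GenFam X) (F : AbPresheaf.{u, v} X) (k : ℕ) : Type (max u v) :=
  globalSections (F.pullback (evk Q k) (dSmooth_evk Q k))

/-- The homomorphism of cochain groups induced by the face map `d_i`. -/
def faceMap (Q : GenFam X) (F : AbPresheaf.{u, v} X) (k : ℕ) (i : Fin (k + 2)) :
    Cochain Q F k →+ Cochain Q F (k + 1) :=
  comap F (evk Q k) (dSmooth_evk Q k) (evk Q (k + 1)) (dSmooth_evk Q (k + 1))
    (face Q k i) (dSmooth_face Q k i) (evk_face Q k i)

/-- The coboundary operator: the alternating sum of the maps induced by the face maps. -/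
def coboundary (Q : GenFam X) (F : AbPresheaf.{u, v} X) (k : ℕ) :
    Cochain Q F k →+ Cochain Q F (k + 1) :=
  ∑ i : Fin (k + 2), ((-1 : ℤ) ^ (i : ℕ)) • faceMap Q F k i

/-- The group of degree `k` cocycles: the kernel of the coboundary operator. -/
def cocycles (Q : GenFam X) (F : AbPresheaf.{u, v} X) (k : ℕ) : AddSubgroup (Cochain Q F k) :=
  (coboundary Q F k).ker

/-- The group of degree `k` coboundaries: the image of the coboundary operator (and zero in degree
zero). -/
def coboundaries (Q : GenFam X) (F : AbPresheaf.{u, v} X) :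
    ∀ k : ℕ, AddSubgroup (Cochain Q F k)
  | 0 => ⊥
  | k + 1 => (coboundary Q F k).range

/-- The Čech cohomology of `F` associated to `Q` in degree `k`: cocycles modulo coboundaries. -/
def CechFam (Q : GenFam X) (F : AbPresheaf.{u, v} X) (k : ℕ) : Type (max u v) :=
  cocycles Q F k ⧸ (coboundaries Q F k).addSubgroupOf (cocycles Q F k)

instance (Q : GenFam X) (F : AbPresheaf.{u, v} X) (k : ℕ) : AddCommGroup (CechFam Q F k) :=
  inferInstanceAs
    (AddCommGroup (cocycles Q F k ⧸ (coboundaries Q F k).addSubgroupOf (cocycles Q F k)))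

/-- The cohomology class of a cocycle. -/
def CechFam.mk (Q : GenFam X) (F : AbPresheaf.{u, v} X) (k : ℕ) :
    cocycles Q F k →+ CechFam Q F k :=
  QuotientAddGroup.mk' _

theorem CechFam.mk_surjective (Q : GenFam X) (F : AbPresheaf.{u, v} X) (k : ℕ) :
    Function.Surjective (CechFam.mk Q F k) :=
  QuotientAddGroup.mk'_surjective _

theorem CechFam.mk_eq_mk {Q : GenFam X} {F : AbPresheaf.{u, v} X} {k : ℕ}
    {η μ : cocycles Q F k} :
    CechFam.mk Q F k η = CechFam.mk Q F k μ ↔ μ.1 - η.1 ∈ coboundaries Q F k := by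
  rw [sub_eq_neg_add]
  exact QuotientAddGroup.eq

end Nebula

/-! ### Maps of generating families and refinements -/

section FamMap

variable {X Y : Type u} [DiffeologicalSpace X] [DiffeologicalSpace Y]

/-- A map of generating families over a smooth map `φ : Y → X`, from the family `R` of `Y` to the
family `Q` of `X`: a map of index sets, and for each plot `r` of `R` a factorization of `φ ∘ r`
through the corresponding plot of `Q`. For `φ = id` these are the data by which `R` refines `Q`. -/
structure FamMap (φ : Y → X) (hφ : DSmooth φ) (Q : GenFam X) (R : GenFam Y) where
  /-- the map of index sets -/
  idx : R.plots → Q.plots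
  /-- the factorizations -/
  hom : ∀ r : R.plots, r.1.map φ hφ ⟶ (idx r).1

namespace FamMap

variable {φ : Y → X} {hφ : DSmooth φ} {Q : GenFam X} {R : GenFam Y}

/-- The induced map of nebulae. -/
def nebulaMap (f : FamMap φ hφ Q R) (x : Nebula R) : Nebula Q :=
  ⟨f.idx x.1, (f.hom x.1).toFun x.2⟩

theorem dSmooth_nebulaMap (f : FamMap φ hφ Q R) : DSmooth f.nebulaMap := by
  intro n p hp x hx
  obtain ⟨V, hV, q, r, hr, H⟩ := hp x hx
  refine ⟨V, hV, f.idx q, fun y => (f.hom q).toFun (r y), (f.hom q).smooth.comp hr, fun y => ?_⟩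
  change f.nebulaMap (p y) = _
  rw [H y]
  rfl

theorem ev_nebulaMap (f : FamMap φ hφ Q R) (x : Nebula R) : ev Q (f.nebulaMap x) = φ (ev R x) :=
  (f.hom x.1).comm x.2

/-- The induced map `N(R)_k → N(Q)_k`. -/
def nerveMap (f : FamMap φ hφ Q R) (k : ℕ) (x : Nerve R k) : Nerve Q k :=
  ⟨fun i => f.nebulaMap (x.1 i), fun i j => by rw [f.ev_nebulaMap, f.ev_nebulaMap, x.2 i j]⟩

theorem dSmooth_nerveMap (f : FamMap φ hφ Q R) (k : ℕ) : DSmooth (f.nerveMap k) :=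
  fun n _ hp i => f.dSmooth_nebulaMap n _ (hp i)

theorem evk_nerveMap (f : FamMap φ hφ Q R) (k : ℕ) (x : Nerve R k) :
    evk Q k (f.nerveMap k x) = φ (evk R k x) := f.ev_nebulaMap _

/-- The induced map of cochains. -/
def cochainMap (f : FamMap φ hφ Q R) (F : AbPresheaf.{u, v} X) (k : ℕ) :
    Cochain Q F k →+ Cochain R (F.pullback φ hφ) k :=
  comap F (evk Q k) (dSmooth_evk Q k) (φ ∘ evk R k) (hφ.comp (dSmooth_evk R k))
    (f.nerveMap k) (f.dSmooth_nerveMap k) (f.evk_nerveMap k)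

theorem faceMap_cochainMap (f : FamMap φ hφ Q R) (F : AbPresheaf.{u, v} X) (k : ℕ)
    (i : Fin (k + 2)) (η : Cochain Q F k) :
    faceMap R (F.pullback φ hφ) k i (f.cochainMap F k η) =
      f.cochainMap F (k + 1) (faceMap Q F k i η) :=
  (comap_comap F (evk Q k) (dSmooth_evk Q k) (φ ∘ evk R k) (hφ.comp (dSmooth_evk R k))
    (φ ∘ evk R (k + 1)) (hφ.comp (dSmooth_evk R (k + 1)))
    (f.nerveMap k) (f.dSmooth_nerveMap k) (f.evk_nerveMap k) (face R k i) (dSmooth_face R k i)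
    (fun x => congrArg φ (evk_face R k i x)) η).trans
  (comap_comap F (evk Q k) (dSmooth_evk Q k) (evk Q (k + 1)) (dSmooth_evk Q (k + 1))
    (φ ∘ evk R (k + 1)) (hφ.comp (dSmooth_evk R (k + 1)))
    (face Q k i) (dSmooth_face Q k i) (evk_face Q k i)
    (f.nerveMap (k + 1)) (f.dSmooth_nerveMap (k + 1)) (f.evk_nerveMap (k + 1)) η).symm

theorem coboundary_cochainMap (f : FamMap φ hφ Q R) (F : AbPresheaf.{u, v} X) (k : ℕ)
    (η : Cochain Q F k) :
    coboundary R (F.pullback φ hφ) k (f.cochainMap F k η) =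
      f.cochainMap F (k + 1) (coboundary Q F k η) := by
  simp only [coboundary, AddMonoidHom.finsetSum_apply, AddMonoidHom.smul_apply, map_sum,
    map_zsmul, faceMap_cochainMap]

/-- The induced map of cocycles. -/
def cocycleMap (f : FamMap φ hφ Q R) (F : AbPresheaf.{u, v} X) (k : ℕ) :
    cocycles Q F k →+ cocycles R (F.pullback φ hφ) k :=
  ((f.cochainMap F k).comp (cocycles Q F k).subtype).codRestrict _ fun η => by
    change coboundary R _ k (f.cochainMap F k η.1) = 0
    rw [coboundary_cochainMap, show coboundary Q F k η.1 = 0 from η.2, map_zero]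

theorem cochainMap_mem_coboundaries (f : FamMap φ hφ Q R) (F : AbPresheaf.{u, v} X) (k : ℕ)
    (η : Cochain Q F k) (hη : η ∈ coboundaries Q F k) :
    f.cochainMap F k η ∈ coboundaries R (F.pullback φ hφ) k := by
  cases k with
  | zero =>
    have : η = 0 := hη
    rw [this, map_zero]
    exact zero_mem _
  | succ k =>
    obtain ⟨μ, rfl⟩ := hη
    exact ⟨f.cochainMap F k μ, f.coboundary_cochainMap F k μ⟩

/-- The induced map of cohomology groups. -/
def cohMap (f : FamMap φ hφ Q R) (F : AbPresheaf.{u, v} X) (k : ℕ) :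
    CechFam Q F k →+ CechFam R (F.pullback φ hφ) k :=
  QuotientAddGroup.map _ _ (f.cocycleMap F k) fun η hη =>
    f.cochainMap_mem_coboundaries F k η.1 hη

theorem cohMap_mk (f : FamMap φ hφ Q R) (F : AbPresheaf.{u, v} X) (k : ℕ) (η : cocycles Q F k) :
    f.cohMap F k (CechFam.mk Q F k η) = CechFam.mk R _ k (f.cocycleMap F k η) := rfl

end FamMap

end FamMap

/-! ### Independence of the choice of factorizations -/

theorem prism_sum {M : Type*} [AddCommGroup M] (A : ℕ → ℕ → M) (n : ℕ) :
    (∑ i ∈ Finset.range (n + 1), ∑ j ∈ Finset.range (n + 2), (-1 : ℤ) ^ (i + j) • A i j) +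
      (∑ j ∈ Finset.range (n + 1), ∑ i ∈ Finset.range n,
        (-1 : ℤ) ^ (i + j) • (if j ≤ i then A (i + 1) j else A i (j + 1))) =
      ∑ i ∈ Finset.range (n + 1), (A i i - A i (i + 1)) := by
  induction n with
  | zero => simp [Finset.sum_range_succ, sub_eq_add_neg]
  | succ n ih =>
    rw [Finset.sum_range_succ (fun i => A i i - A i (i + 1)) (n + 1), ← ih,
      Finset.sum_range_succ _ (n + 1),
      Finset.sum_congr rfl (fun i _ => Finset.sum_range_succ
        (fun j => (-1 : ℤ) ^ (i + j) • A i j) (n + 2)), Finset.sum_add_distrib,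
      Finset.sum_range_succ (fun j => ∑ i ∈ Finset.range (n + 1),
        (-1 : ℤ) ^ (i + j) • (if j ≤ i then A (i + 1) j else A i (j + 1))) (n + 1),
      Finset.sum_congr rfl (fun j _ => Finset.sum_range_succ
        (fun i => (-1 : ℤ) ^ (i + j) • (if j ≤ i then A (i + 1) j else A i (j + 1))) n),
      Finset.sum_add_distrib,
      Finset.sum_range_succ (fun j => (-1 : ℤ) ^ (n + 1 + j) • A (n + 1) j) (n + 2),
      Finset.sum_range_succ (fun j => (-1 : ℤ) ^ (n + 1 + j) • A (n + 1) j) (n + 1)]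
    have h1 : ∑ j ∈ Finset.range (n + 1),
        (-1 : ℤ) ^ (n + j) • (if j ≤ n then A (n + 1) j else A n (j + 1)) =
        -∑ j ∈ Finset.range (n + 1), (-1 : ℤ) ^ (n + 1 + j) • A (n + 1) j := by
      rw [← Finset.sum_neg_distrib]
      refine Finset.sum_congr rfl fun j hj => ?_
      rw [if_pos (by simpa [Nat.lt_succ_iff] using hj), ← neg_smul]
      congr 1
      ring
    have h2 : ∑ i ∈ Finset.range (n + 1),
        (-1 : ℤ) ^ (i + (n + 1)) • (if n + 1 ≤ i then A (i + 1) (n + 1) else A i (n + 1 + 1)) =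
        -∑ i ∈ Finset.range (n + 1), (-1 : ℤ) ^ (i + (n + 2)) • A i (n + 2) := by
      rw [← Finset.sum_neg_distrib]
      refine Finset.sum_congr rfl fun j hj => ?_
      rw [if_neg (by simpa using hj), ← neg_smul]
      congr 1
      ring
    have h3 : (-1 : ℤ) ^ (n + 1 + (n + 1)) = 1 := Even.neg_one_pow ⟨_, rfl⟩
    have h4 : (-1 : ℤ) ^ (n + 1 + (n + 2)) = -1 := by
      rw [← add_assoc (n + 1) (n + 1) 1, pow_succ, h3, one_mul]
    rw [h1, h2, h3, h4, one_smul, neg_smul, one_smul]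
    abel

section Homotopy

variable {X Y : Type u} [DiffeologicalSpace X] [DiffeologicalSpace Y]

section

variable {φ : Y → X} (hφ : DSmooth φ) (Q : GenFam X) (R : GenFam Y) (F : AbPresheaf.{u, v} X)

/-- The homomorphism of cochain groups induced by a smooth map `N(R)_k → N(Q)_l` over `φ`. -/
def nerveComap {k l : ℕ} (h : Nerve R k → Nerve Q l) (hh : DSmooth h)
    (hc : ∀ x, evk Q l (h x) = φ (evk R k x)) :
    Cochain Q F l →+ Cochain R (F.pullback φ hφ) k :=
  comap F (evk Q l) (dSmooth_evk Q l) (φ ∘ evk R k) (hφ.comp (dSmooth_evk R k)) h hh hc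

variable {Q R}

theorem faceMap_nerveComap {k l : ℕ} (h : Nerve R k → Nerve Q l) (hh : DSmooth h)
    (hc : ∀ x, evk Q l (h x) = φ (evk R k x)) (i : Fin (k + 2)) (η : Cochain Q F l) :
    faceMap R (F.pullback φ hφ) k i (nerveComap hφ Q R F h hh hc η) =
      nerveComap hφ Q R F (h ∘ face R k i) (hh.comp (dSmooth_face R k i))
        (fun x => (hc _).trans (congrArg φ (evk_face R k i x))) η :=
  comap_comap F (evk Q l) (dSmooth_evk Q l) (φ ∘ evk R k) (hφ.comp (dSmooth_evk R k))
    (φ ∘ evk R (k + 1)) (hφ.comp (dSmooth_evk R (k + 1))) h hh hc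
    (face R k i) (dSmooth_face R k i) (fun x => congrArg φ (evk_face R k i x)) η

theorem nerveComap_faceMap {k l : ℕ} (h : Nerve R k → Nerve Q (l + 1)) (hh : DSmooth h)
    (hc : ∀ x, evk Q (l + 1) (h x) = φ (evk R k x)) (i : Fin (l + 2)) (η : Cochain Q F l) :
    nerveComap hφ Q R F h hh hc (faceMap Q F l i η) =
      nerveComap hφ Q R F (face Q l i ∘ h) ((dSmooth_face Q l i).comp hh)
        (fun x => (evk_face Q l i _).trans (hc x)) η :=
  comap_comap F (evk Q l) (dSmooth_evk Q l) (evk Q (l + 1)) (dSmooth_evk Q (l + 1))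
    (φ ∘ evk R k) (hφ.comp (dSmooth_evk R k))
    (face Q l i) (dSmooth_face Q l i) (evk_face Q l i) h hh hc η

theorem nerveComap_congr {k l : ℕ} {h h' : Nerve R k → Nerve Q l} (e : h = h') (hh : DSmooth h)
    (hh' : DSmooth h') (hc : ∀ x, evk Q l (h x) = φ (evk R k x))
    (hc' : ∀ x, evk Q l (h' x) = φ (evk R k x)) (η : Cochain Q F l) :
    nerveComap hφ Q R F h hh hc η = nerveComap hφ Q R F h' hh' hc' η := by
  subst e
  rfl

end

namespace FamMap

variable {φ : Y → X} {hφ : DSmooth φ} {Q : GenFam X} {R : GenFam Y}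

/-- The map `(x₀, …, x_k) ↦ (f x₀, …, f x_i, g x_i, …, g x_k)` for `i ≤ k`. -/
def prism (f g : FamMap φ hφ Q R) (k i : ℕ) (x : Nerve R k) : Nerve Q (k + 1) :=
  ⟨fun j => if j.1 ≤ i then f.nebulaMap (x.1 ⟨min j.1 k, by omega⟩)
      else g.nebulaMap (x.1 ⟨j.1 - 1, by omega⟩), fun a b => by
    have key : ∀ c : Fin (k + 2), ev Q (if c.1 ≤ i then f.nebulaMap (x.1 ⟨min c.1 k, by omega⟩)
        else g.nebulaMap (x.1 ⟨c.1 - 1, by omega⟩)) = φ (ev R (x.1 0)) := by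
      intro c
      split_ifs
      · rw [f.ev_nebulaMap, x.2 _ 0]
      · rw [g.ev_nebulaMap, x.2 _ 0]
    exact (key a).trans (key b).symm⟩

theorem dSmooth_prism (f g : FamMap φ hφ Q R) (k i : ℕ) : DSmooth (f.prism g k i) := by
  intro n p hp j
  by_cases h : j.1 ≤ i
  · have := f.dSmooth_nebulaMap n _ (hp ⟨min j.1 k, by omega⟩)
    convert! this using 1
    funext y
    simp [prism, h]
  · have := g.dSmooth_nebulaMap n _ (hp ⟨j.1 - 1, by omega⟩)
    convert! this using 1
    funext y
    simp [prism, h]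

theorem evk_prism (f g : FamMap φ hφ Q R) (k i : ℕ) (x : Nerve R k) :
    evk Q (k + 1) (f.prism g k i x) = φ (evk R k x) := f.ev_nebulaMap _

theorem face_prism_eq (f g : FamMap φ hφ Q R) (k i : ℕ) (hi : i < k) :
    face Q k ⟨i + 1, by omega⟩ ∘ f.prism g k i =
      face Q k ⟨i + 1, by omega⟩ ∘ f.prism g k (i + 1) := by
  funext x
  refine Subtype.ext (funext fun j => ?_)
  simp only [face, prism, Function.comp, Fin.succAbove, Fin.lt_def, Fin.val_castSucc]
  split_ifs <;> simp_all <;> omega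

theorem face_zero_prism (f g : FamMap φ hφ Q R) (k : ℕ) :
    face Q k 0 ∘ f.prism g k 0 = g.nerveMap k := by
  funext x
  refine Subtype.ext (funext fun j => ?_)
  simp [face, prism, nerveMap]

theorem face_last_prism (f g : FamMap φ hφ Q R) (k : ℕ) :
    face Q k ⟨k + 1, by omega⟩ ∘ f.prism g k k = f.nerveMap k := by
  funext x
  refine Subtype.ext (funext fun j => ?_)
  have h1 : j.1 ≤ k := by omega
  simp [face, prism, nerveMap, Fin.succAbove, Fin.lt_def, h1]

theorem prism_apply_le (f g : FamMap φ hφ Q R) (k i : ℕ) (x : Nerve R k) (c : Fin (k + 2))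
    (h : c.1 ≤ i) (d : Fin (k + 1)) (hd : d.1 = c.1) :
    (f.prism g k i x).1 c = f.nebulaMap (x.1 d) := by
  simp only [prism, if_pos h]
  congr 1
  exact congrArg x.1 (Fin.ext (by simp only; omega))

theorem prism_apply_gt (f g : FamMap φ hφ Q R) (k i : ℕ) (x : Nerve R k) (c : Fin (k + 2))
    (h : i < c.1) (d : Fin (k + 1)) (hd : d.1 + 1 = c.1) :
    (f.prism g k i x).1 c = g.nebulaMap (x.1 d) := by
  simp only [prism, if_neg (not_le.2 h)]
  congr 1
  exact congrArg x.1 (Fin.ext (by simp only; omega))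

theorem val_succAbove {n : ℕ} (j : Fin (n + 1)) (c : Fin n) :
    (j.succAbove c).1 = if c.1 < j.1 then c.1 else c.1 + 1 := by
  simp only [Fin.succAbove, Fin.lt_def, Fin.val_castSucc]
  split_ifs <;> rfl

theorem prism_face_le (f g : FamMap φ hφ Q R) (k i j : ℕ) (hi : i < k + 1) (hji : j ≤ i) :
    f.prism g k i ∘ face R k ⟨j, by omega⟩ =
      face Q (k + 1) ⟨j, by omega⟩ ∘ f.prism g (k + 1) (i + 1) := by
  funext x
  refine Subtype.ext (funext fun c => ?_)
  have hv := val_succAbove (⟨j, by omega⟩ : Fin (k + 3)) c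
  by_cases h1 : c.1 ≤ i
  · have hd := val_succAbove (⟨j, by omega⟩ : Fin (k + 2)) ⟨c.1, by omega⟩
    refine (f.prism_apply_le g k i _ c h1 ⟨c.1, by omega⟩ rfl).trans
      (f.prism_apply_le g (k + 1) (i + 1) x _ ?_ _ ?_).symm <;> grind
  · have hd := val_succAbove (⟨j, by omega⟩ : Fin (k + 2)) ⟨c.1 - 1, by omega⟩
    refine (f.prism_apply_gt g k i _ c (by omega) ⟨c.1 - 1, by omega⟩ (by grind)).trans
      (f.prism_apply_gt g (k + 1) (i + 1) x _ ?_ _ ?_).symm <;> grind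

theorem prism_face_gt (f g : FamMap φ hφ Q R) (k i j : ℕ) (hj : j < k + 2) (hij : i < j) :
    f.prism g k i ∘ face R k ⟨j, hj⟩ =
      face Q (k + 1) ⟨j + 1, by omega⟩ ∘ f.prism g (k + 1) i := by
  funext x
  refine Subtype.ext (funext fun c => ?_)
  have hv := val_succAbove (⟨j + 1, by omega⟩ : Fin (k + 3)) c
  by_cases h1 : c.1 ≤ i
  · have hd := val_succAbove (⟨j, by omega⟩ : Fin (k + 2)) ⟨c.1, by omega⟩
    refine (f.prism_apply_le g k i _ c h1 ⟨c.1, by omega⟩ rfl).trans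
      (f.prism_apply_le g (k + 1) i x _ ?_ _ ?_).symm <;> grind
  · have hd := val_succAbove (⟨j, by omega⟩ : Fin (k + 2)) ⟨c.1 - 1, by omega⟩
    refine (f.prism_apply_gt g k i _ c (by omega) ⟨c.1 - 1, by omega⟩ (by grind)).trans
      (f.prism_apply_gt g (k + 1) i x _ ?_ _ ?_).symm <;> grind

/-- The prism operator. -/
def prismMap (f g : FamMap φ hφ Q R) (F : AbPresheaf.{u, v} X) (k : ℕ) :
    Cochain Q F (k + 1) →+ Cochain R (F.pullback φ hφ) k :=
  ∑ i : Fin (k + 1), ((-1 : ℤ) ^ (i : ℕ)) •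
    nerveComap hφ Q R F (f.prism g k i) (f.dSmooth_prism g k i) (f.evk_prism g k i)

/-- The terms of the double sums that occur in the prism identity. -/
def prismTerm (f g : FamMap φ hφ Q R) (F : AbPresheaf.{u, v} X) (k : ℕ) (η : Cochain Q F k)
    (i j : ℕ) : Cochain R (F.pullback φ hφ) k :=
  nerveComap hφ Q R F (face Q k (Fin.ofNat _ j) ∘ f.prism g k i)
    ((dSmooth_face Q k _).comp (f.dSmooth_prism g k i))
    (fun x => (evk_face Q k _ _).trans (f.evk_prism g k i x)) η

theorem prismMap_coboundary (f g : FamMap φ hφ Q R) (F : AbPresheaf.{u, v} X) (k : ℕ)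
    (η : Cochain Q F k) :
    f.prismMap g F k (coboundary Q F k η) =
      ∑ i ∈ Finset.range (k + 1), ∑ j ∈ Finset.range (k + 2),
        (-1 : ℤ) ^ (i + j) • f.prismTerm g F k η i j := by
  simp only [prismMap, coboundary, AddMonoidHom.finsetSum_apply, AddMonoidHom.smul_apply, map_sum,
    map_zsmul, nerveComap_faceMap, Finset.smul_sum, smul_smul]
  rw [Finset.sum_comm, ← Fin.sum_univ_eq_sum_range
    (fun i => ∑ j ∈ Finset.range (k + 2), (-1 : ℤ) ^ (i + j) • f.prismTerm g F k η i j)]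
  apply Finset.sum_congr rfl
  intro i _
  rw [← Fin.sum_univ_eq_sum_range (fun j => (-1 : ℤ) ^ (i.1 + j) • f.prismTerm g F k η i j)]
  apply Finset.sum_congr rfl
  intro j _
  rw [pow_add, mul_comm]
  congr 1
  refine nerveComap_congr hφ F ?_ _ _ _ _ η
  rw [Fin.ofNat_val_eq_self]

theorem coboundary_prismMap (f g : FamMap φ hφ Q R) (F : AbPresheaf.{u, v} X) (k : ℕ)
    (η : Cochain Q F (k + 1)) :
    coboundary R (F.pullback φ hφ) k (f.prismMap g F k η) =
      ∑ j ∈ Finset.range (k + 2), ∑ i ∈ Finset.range (k + 1),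
        (-1 : ℤ) ^ (i + j) • (if j ≤ i then f.prismTerm g F (k + 1) η (i + 1) j
          else f.prismTerm g F (k + 1) η i (j + 1)) := by
  simp only [prismMap, coboundary, AddMonoidHom.finsetSum_apply, AddMonoidHom.smul_apply, map_sum,
    map_zsmul, faceMap_nerveComap, Finset.smul_sum, smul_smul]
  rw [Finset.sum_comm, ← Fin.sum_univ_eq_sum_range (fun j => ∑ i ∈ Finset.range (k + 1),
        (-1 : ℤ) ^ (i + j) • (if j ≤ i then f.prismTerm g F (k + 1) η (i + 1) j
          else f.prismTerm g F (k + 1) η i (j + 1)))]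
  apply Finset.sum_congr rfl
  intro j _
  rw [← Fin.sum_univ_eq_sum_range (fun i =>
        (-1 : ℤ) ^ (i + j.1) • (if j.1 ≤ i then f.prismTerm g F (k + 1) η (i + 1) j
          else f.prismTerm g F (k + 1) η i (j.1 + 1)))]
  apply Finset.sum_congr rfl
  intro i _
  rw [pow_add]
  congr 1
  have hi := i.2
  have hj := j.2
  split_ifs with h
  · refine nerveComap_congr hφ F ?_ _ _ _ _ η
    rw [show (Fin.ofNat (k + 3) j.1) = ⟨j.1, by omega⟩ from
      Fin.ext (Nat.mod_eq_of_lt (by omega)), ← f.prism_face_le g k i j hi h]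
  · refine nerveComap_congr hφ F ?_ _ _ _ _ η
    rw [show (Fin.ofNat (k + 3) (j.1 + 1)) = ⟨j.1 + 1, by omega⟩ from
      Fin.ext (Nat.mod_eq_of_lt (by omega)), ← f.prism_face_gt g k i j hj (by omega)]

theorem sum_prismTerm (f g : FamMap φ hφ Q R) (F : AbPresheaf.{u, v} X) (k : ℕ)
    (η : Cochain Q F k) :
    ∑ i ∈ Finset.range (k + 1), (f.prismTerm g F k η i i - f.prismTerm g F k η i (i + 1)) =
      g.cochainMap F k η - f.cochainMap F k η := by
  have h : ∀ n, n ≤ k → ∑ i ∈ Finset.range (n + 1),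
      (f.prismTerm g F k η i i - f.prismTerm g F k η i (i + 1)) =
      g.cochainMap F k η - f.prismTerm g F k η n (n + 1) := by
    intro n
    induction n with
    | zero =>
      intro _
      rw [Finset.sum_range_one]
      refine congrArg (fun z => z - f.prismTerm g F k η 0 1) ?_
      exact nerveComap_congr hφ F (f.face_zero_prism g k) _ _ _ _ η
    | succ n ih =>
      intro hn
      rw [Finset.sum_range_succ, ih (by omega)]
      have : f.prismTerm g F k η n (n + 1) = f.prismTerm g F k η (n + 1) (n + 1) := by
        refine nerveComap_congr hφ F ?_ _ _ _ _ η
        rw [show (Fin.ofNat (k + 2) (n + 1)) = ⟨n + 1, by omega⟩ from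
          Fin.ext (Nat.mod_eq_of_lt (by omega))]
        exact f.face_prism_eq g k n (by omega)
      rw [this, sub_add_sub_cancel]
  rw [h k le_rfl]
  congr 1
  refine nerveComap_congr hφ F ?_ _ _ _ _ η
  rw [show (Fin.ofNat (k + 2) (k + 1)) = ⟨k + 1, by omega⟩ from
    Fin.ext (Nat.mod_eq_of_lt (by omega))]
  exact f.face_last_prism g k

/-- Two maps of generating families over the same smooth map send a cocycle to cohomologous
cocycles. -/
theorem cochainMap_sub_mem (f g : FamMap φ hφ Q R) (F : AbPresheaf.{u, v} X) (k : ℕ)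
    (η : Cochain Q F k) (hη : coboundary Q F k η = 0) :
    g.cochainMap F k η - f.cochainMap F k η ∈ coboundaries R (F.pullback φ hφ) k := by
  have h1 := f.prismMap_coboundary g F k η
  rw [hη, map_zero] at h1
  rw [← f.sum_prismTerm g F k η]
  cases k with
  | zero =>
    have h := prism_sum (f.prismTerm g F 0 η) 0
    rw [← h, ← h1]
    simp only [Finset.range_zero, Finset.sum_empty, Finset.sum_const_zero, add_zero]
    exact zero_mem _
  | succ k =>
    rw [← prism_sum (f.prismTerm g F (k + 1) η) (k + 1), ← h1, zero_add,
      ← f.coboundary_prismMap g F k η]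
    exact ⟨_, rfl⟩

theorem cohMap_eq (f g : FamMap φ hφ Q R) (F : AbPresheaf.{u, v} X) (k : ℕ) :
    f.cohMap F k = g.cohMap F k := by
  refine AddMonoidHom.ext fun c => ?_
  obtain ⟨η, rfl⟩ := CechFam.mk_surjective Q F k c
  rw [cohMap_mk, cohMap_mk]
  exact CechFam.mk_eq_mk.2 (f.cochainMap_sub_mem g F k η.1 η.2)

/-- Composition of maps of generating families. -/
def comp {Z : Type u} [DiffeologicalSpace Z] {ψ : Z → Y} {hψ : DSmooth ψ} {S : GenFam Z}
    (f : FamMap φ hφ Q R) (g : FamMap ψ hψ R S) : FamMap (φ ∘ ψ) (hφ.comp hψ) Q S where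
  idx s := f.idx (g.idx s)
  hom s := (plotFunctor φ hφ).map (g.hom s) ≫ f.hom (g.idx s)

theorem cohMap_comp {Z : Type u} [DiffeologicalSpace Z] {ψ : Z → Y} {hψ : DSmooth ψ}
    {S : GenFam Z} (f : FamMap φ hφ Q R) (g : FamMap ψ hψ R S) (F : AbPresheaf.{u, v} X) (k : ℕ)
    (c : CechFam Q F k) :
    g.cohMap (F.pullback φ hφ) k (f.cohMap F k c) = (f.comp g).cohMap F k c := by
  obtain ⟨η, rfl⟩ := CechFam.mk_surjective Q F k c
  rw [cohMap_mk, cohMap_mk, cohMap_mk]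
  refine congrArg (CechFam.mk S _ k) (Subtype.ext ?_)
  exact comap_comap F (evk Q k) (dSmooth_evk Q k) (φ ∘ evk R k) (hφ.comp (dSmooth_evk R k))
    ((φ ∘ ψ) ∘ evk S k) ((hφ.comp hψ).comp (dSmooth_evk S k))
    (f.nerveMap k) (f.dSmooth_nerveMap k) (f.evk_nerveMap k)
    (g.nerveMap k) (g.dSmooth_nerveMap k) (fun x => congrArg φ (g.evk_nerveMap k x)) η.1

/-- The identity map of a generating family. -/
def refl (Q : GenFam X) : FamMap id dSmooth_id Q Q where
  idx q := q
  hom q := 𝟙 q.1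

theorem cohMap_refl (F : AbPresheaf.{u, v} X) (k : ℕ) (c : CechFam Q F k) :
    (refl Q).cohMap F k c = c := by
  obtain ⟨η, rfl⟩ := CechFam.mk_surjective Q F k c
  rw [cohMap_mk]
  refine congrArg (CechFam.mk Q F k) (Subtype.ext ?_)
  exact comap_id F (evk Q k) (dSmooth_evk Q k) η.1

end FamMap

end Homotopy

/-! ### The colimit over all generating families -/

section Colimit

variable {X Y : Type u} [DiffeologicalSpace X] [DiffeologicalSpace Y]

/-- The data by which `R` refines `Q`: a map of index sets and, for each plot `r` of `R`, a smooth
factorization of `r` through the corresponding plot of `Q`. -/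
abbrev Refinement (Q R : GenFam X) := FamMap id dSmooth_id Q R

/-- Generating families are preordered by refinement: `Q ≤ R` if `R` is a refinement of `Q`. -/
instance : Preorder (GenFam X) where
  le Q R := Nonempty (Refinement Q R)
  le_refl Q := ⟨FamMap.refl Q⟩
  le_trans _ _ _ := fun ⟨f⟩ ⟨g⟩ => ⟨f.comp g⟩

/-- The generating family of all plots. -/
instance : Nonempty (GenFam X) :=
  ⟨⟨Set.univ, fun p x => ⟨p.dom, le_rfl, x.2, p, trivial, ⟨𝟙 p⟩⟩⟩⟩

/-- The inclusion of a smaller restriction of a plot into a larger one. -/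
def Plot.restrictHom (p : Plot X) (V W : Opens (EuclideanSpace ℝ (Fin p.dim))) (hV : V ≤ p.dom)
    (hW : W ≤ p.dom) (hVW : V ≤ W) : p.restrict V hV ⟶ p.restrict W hW :=
  Plot.Hom.mk (fun x => ⟨x.1, hVW x.2⟩) (fun _ g hg => show IsPlot (fun z => (g z).1) from hg)
    fun _ => rfl

/-- Any two generating families have a common refinement. -/
instance : IsDirectedOrder (GenFam X) where
  directed Q R := by
    refine ⟨⟨{s | (∃ q ∈ Q.plots, Nonempty (s ⟶ q)) ∧ ∃ r ∈ R.plots, Nonempty (s ⟶ r)},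
      fun p x => ?_⟩, ⟨⟨fun s => ⟨_, s.2.1.choose_spec.1⟩, fun s => s.2.1.choose_spec.2.some⟩⟩,
      ⟨⟨fun s => ⟨_, s.2.2.choose_spec.1⟩, fun s => s.2.2.choose_spec.2.some⟩⟩⟩
    obtain ⟨V, hV, hxV, q, hq, ⟨f⟩⟩ := Q.generates p x
    obtain ⟨W, hW, hxW, r, hr, ⟨g⟩⟩ := R.generates p x
    exact ⟨V ⊓ W, inf_le_left.trans hV, ⟨hxV, hxW⟩, p.restrict (V ⊓ W) (inf_le_left.trans hV),
      ⟨⟨q, hq, ⟨p.restrictHom _ V _ hV inf_le_left ≫ f⟩⟩,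
        ⟨r, hr, ⟨p.restrictHom _ W _ hW inf_le_right ≫ g⟩⟩⟩, ⟨𝟙 _⟩⟩

/-- The homomorphism of cohomology groups induced by the data of a refinement. -/
def FamMap.refMap {Q R : GenFam X} (f : Refinement Q R) (F : AbPresheaf.{u, v} X) (k : ℕ) :
    CechFam Q F k →+ CechFam R F k :=
  FamMap.cohMap f F k

theorem FamMap.refMap_eq {Q R : GenFam X} (f g : Refinement Q R) (F : AbPresheaf.{u, v} X)
    (k : ℕ) : f.refMap F k = g.refMap F k :=
  FamMap.cohMap_eq f g F k

theorem FamMap.refMap_refl (Q : GenFam X) (F : AbPresheaf.{u, v} X) (k : ℕ)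
    (c : CechFam Q F k) : (FamMap.refl Q).refMap F k c = c :=
  FamMap.cohMap_refl F k c

theorem FamMap.cohMap_refMap {φ : Y → X} {hφ : DSmooth φ} {Q Q' : GenFam X} {R : GenFam Y}
    (e : Refinement Q Q') (f : FamMap φ hφ Q' R) (g : FamMap φ hφ Q R) (F : AbPresheaf.{u, v} X)
    (k : ℕ) (c : CechFam Q F k) : f.cohMap F k (e.refMap F k c) = g.cohMap F k c :=
  (FamMap.cohMap_comp e f F k c).trans
    (DFunLike.congr_fun (FamMap.cohMap_eq (FamMap.comp e f) g F k) c)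

theorem FamMap.refMap_cohMap {φ : Y → X} {hφ : DSmooth φ} {Q : GenFam X} {R R' : GenFam Y}
    (f : FamMap φ hφ Q R) (e : Refinement R R') (g : FamMap φ hφ Q R') (F : AbPresheaf.{u, v} X)
    (k : ℕ) (c : CechFam Q F k) :
    FamMap.refMap e (F.pullback φ hφ) k (f.cohMap F k c) = g.cohMap F k c :=
  (FamMap.cohMap_comp f e F k c).trans
    (DFunLike.congr_fun (FamMap.cohMap_eq (FamMap.comp f e) g F k) c)

theorem FamMap.refMap_refMap {Q R S : GenFam X} (f : Refinement Q R) (g : Refinement R S)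
    (h : Refinement Q S) (F : AbPresheaf.{u, v} X) (k : ℕ) (c : CechFam Q F k) :
    g.refMap F k (f.refMap F k c) = h.refMap F k c :=
  FamMap.cohMap_refMap f g h F k c

/-- The homomorphism of cohomology groups induced by a refinement; by `FamMap.refMap_eq` it does
not depend on the data of the refinement. -/
def refineMap (F : AbPresheaf.{u, v} X) (k : ℕ) (Q R : GenFam X) (h : Q ≤ R) :
    CechFam Q F k →+ CechFam R F k :=
  FamMap.refMap (Classical.choice h) F k

instance (F : AbPresheaf.{u, v} X) (k : ℕ) :
    DirectedSystem (fun Q : GenFam X => CechFam Q F k) (refineMap F k · · ·) where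
  map_self Q c := by
    rw [refineMap, FamMap.refMap_eq _ (FamMap.refl Q), FamMap.refMap_refl]
  map_map Q R S hRS hSQ c := FamMap.refMap_refMap _ _ _ F k c

/-- The Čech cohomology group of `X` with values in the presheaf `F`, in degree `k`: the direct
limit of the groups associated to the generating families, ordered by refinement. -/
def Cech (F : AbPresheaf.{u, v} X) (k : ℕ) : Type (max u v) :=
  DirectLimit (fun Q : GenFam X => CechFam Q F k) (refineMap F k)

instance (F : AbPresheaf.{u, v} X) (k : ℕ) : AddCommGroup (Cech F k) :=
  inferInstanceAs
    (AddCommGroup (DirectLimit (fun Q : GenFam X => CechFam Q F k) (refineMap F k)))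

/-- The class in `Ȟ^k(X, F)` of a class associated to a generating family. -/
def Cech.of (F : AbPresheaf.{u, v} X) (k : ℕ) (Q : GenFam X) : CechFam Q F k →+ Cech F k where
  toFun c := (⟦⟨Q, c⟩⟧ : DirectLimit (fun Q : GenFam X => CechFam Q F k) (refineMap F k))
  map_zero' := (DirectLimit.zero_def (G := fun Q : GenFam X => CechFam Q F k)
    (f := refineMap F k) Q).symm
  map_add' c d := (DirectLimit.add_def (G := fun Q : GenFam X => CechFam Q F k)
    (f := refineMap F k) Q c d).symm

theorem Cech.of_refineMap (F : AbPresheaf.{u, v} X) (k : ℕ) {Q R : GenFam X} (h : Q ≤ R)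
    (c : CechFam Q F k) : Cech.of F k R (refineMap F k Q R h c) = Cech.of F k Q c :=
  (DirectLimit.eq_of_le (F := fun Q : GenFam X => CechFam Q F k) (f := refineMap F k)
    ⟨Q, c⟩ R h).symm

theorem Cech.exists_of₂ (F : AbPresheaf.{u, v} X) (k : ℕ) (a b : Cech F k) :
    ∃ (Q : GenFam X) (c d : CechFam Q F k), a = Cech.of F k Q c ∧ b = Cech.of F k Q d :=
  DirectLimit.exists_eq_mk₂ (F := fun Q : GenFam X => CechFam Q F k) (refineMap F k) a b

/-- The generating family of `Y` of all plots whose composition with `φ : Y → X` factors through a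
plot in the generating family `Q` of `X`. -/
def GenFam.comap (φ : Y → X) (hφ : DSmooth φ) (Q : GenFam X) : GenFam Y where
  plots := {s | ∃ q ∈ Q.plots, Nonempty (s.map φ hφ ⟶ q)}
  generates p x := by
    obtain ⟨V, hV, hxV, q, hq, ⟨f⟩⟩ := Q.generates (p.map φ hφ) x
    exact ⟨V, hV, hxV, p.restrict V hV, ⟨q, hq, ⟨f⟩⟩, ⟨𝟙 _⟩⟩

/-- The tautological map of generating families over `φ`. -/
def FamMap.ofComap (φ : Y → X) (hφ : DSmooth φ) (Q : GenFam X) :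
    FamMap φ hφ Q (Q.comap φ hφ) where
  idx s := ⟨_, s.2.choose_spec.1⟩
  hom s := s.2.choose_spec.2.some

/-- Maps of generating families over `φ` that are related by refinement induce the same
homomorphism to the colimit. -/
theorem FamMap.of_cohMap {φ : Y → X} {hφ : DSmooth φ} {Q Q' : GenFam X} {R R' : GenFam Y}
    (f : FamMap φ hφ Q R) (f' : FamMap φ hφ Q' R') (h : Q ≤ Q') (F : AbPresheaf.{u, v} X) (k : ℕ)
    (c : CechFam Q F k) :
    Cech.of (F.pullback φ hφ) k R (f.cohMap F k c) =
      Cech.of (F.pullback φ hφ) k R' (f'.cohMap F k (refineMap F k Q Q' h c)) := by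
  obtain ⟨S, hRS, hRS'⟩ := exists_ge_ge R R'
  rw [← Cech.of_refineMap _ k hRS, ← Cech.of_refineMap _ k hRS', refineMap, refineMap, refineMap,
    FamMap.refMap_cohMap f _ (f.comp hRS.some),
    FamMap.refMap_cohMap f' _ (f'.comp hRS'.some),
    FamMap.cohMap_refMap _ (f'.comp hRS'.some) (f.comp hRS.some)]

/-- The underlying function of `Cech.pullback`. -/
def Cech.pullbackFun (φ : Y → X) (hφ : DSmooth φ) (F : AbPresheaf.{u, v} X) (k : ℕ) :
    Cech F k → Cech (F.pullback φ hφ) k :=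
  DirectLimit.lift (refineMap F k)
    (fun Q c => Cech.of (F.pullback φ hφ) k (Q.comap φ hφ)
      ((FamMap.ofComap φ hφ Q).cohMap F k c))
    fun Q R h c => (FamMap.ofComap φ hφ Q).of_cohMap (FamMap.ofComap φ hφ R) h F k c

theorem Cech.pullbackFun_of (φ : Y → X) (hφ : DSmooth φ) (F : AbPresheaf.{u, v} X) (k : ℕ)
    (Q : GenFam X) (c : CechFam Q F k) :
    Cech.pullbackFun φ hφ F k (Cech.of F k Q c) =
      Cech.of (F.pullback φ hφ) k (Q.comap φ hφ) ((FamMap.ofComap φ hφ Q).cohMap F k c) := rfl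

/-- The homomorphism `φ^* : Ȟ^k(X, F) → Ȟ^k(Y, φ^*F)` induced by a smooth map `φ : Y → X`. -/
def Cech.pullback (φ : Y → X) (hφ : DSmooth φ) (F : AbPresheaf.{u, v} X) (k : ℕ) :
    Cech F k →+ Cech (F.pullback φ hφ) k :=
  AddMonoidHom.mk' (Cech.pullbackFun φ hφ F k) fun a b => by
    obtain ⟨Q, c, d, rfl, rfl⟩ := Cech.exists_of₂ F k a b
    rw [← map_add, Cech.pullbackFun_of, Cech.pullbackFun_of, Cech.pullbackFun_of, map_add,
      map_add]

/-- The map `φ^*` can be computed with any map of generating families over `φ`. -/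
theorem Cech.pullback_of {φ : Y → X} {hφ : DSmooth φ} {Q : GenFam X} {R : GenFam Y}
    (f : FamMap φ hφ Q R) (F : AbPresheaf.{u, v} X) (k : ℕ) (c : CechFam Q F k) :
    Cech.pullback φ hφ F k (Cech.of F k Q c) =
      Cech.of (F.pullback φ hφ) k R (f.cohMap F k c) := by
  have h := (FamMap.ofComap φ hφ Q).of_cohMap f le_rfl F k c
  rw [refineMap, FamMap.refMap_eq _ (FamMap.refl Q), FamMap.refMap_refl] at h
  exact h

end Colimit

/-! ### The sheaf of smooth functions into an abelian diffeological group -/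

/-- Abelian diffeological groups, written additively: the addition and the negation are smooth. -/
class DiffeologicalAddCommGroup (G : Type v) [AddCommGroup G] [DiffeologicalSpace G] : Prop where
  dSmooth_add : DSmooth (fun p : G × G => p.1 + p.2)
  dSmooth_neg : DSmooth (fun g : G => -g)

section SmoothSheaf

variable (G : Type v) [AddCommGroup G] [DiffeologicalSpace G] [DiffeologicalAddCommGroup G]

/-- The group `C^∞(U, G)` of smooth maps, with pointwise operations. -/
def smoothMaps (U : Type w) [DiffeologicalSpace U] : AddSubgroup (U → G) where
  carrier := {f | DSmooth f}
  add_mem' {f g} hf hg n p hp :=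
    DiffeologicalAddCommGroup.dSmooth_add n (fun y => (f (p y), g (p y))) ⟨hf n p hp, hg n p hp⟩
  zero_mem' := dSmooth_const
  neg_mem' hf := DiffeologicalAddCommGroup.dSmooth_neg.comp hf

/-- The sheaf `C^∞(·, G)` on the category of plots of `X`: it sends a plot to the group of smooth
maps from its domain to `G`, and acts on morphisms by precomposition. -/
def smoothSheaf (X : Type u) [DiffeologicalSpace X] : AbPresheaf.{u, v} X where
  obj p := AddCommGrpCat.of (smoothMaps G p.unop.dom)
  map {p q} f := AddCommGrpCat.ofHom
    { toFun := fun g => ⟨g.1 ∘ f.unop.toFun, g.2.comp f.unop.smooth⟩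
      map_zero' := rfl
      map_add' := fun _ _ => rfl }

variable {G} in
theorem pullback_smoothSheaf {X Y : Type u} [DiffeologicalSpace X] [DiffeologicalSpace Y]
    (φ : Y → X) (hφ : DSmooth φ) : (smoothSheaf G X).pullback φ hφ = smoothSheaf G Y := rfl

/-- The first Čech cohomology group `Ȟ¹(X, G)` of the sheaf `C^∞(·, G)`. -/
abbrev H1 (X : Type u) [DiffeologicalSpace X] : Type (max u v) := Cech (smoothSheaf G X) 1

/-- The homomorphism `φ^* : Ȟ¹(X, G) → Ȟ¹(Y, G)` induced by a smooth map `φ : Y → X`; here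
`φ^* C^∞(·, G) = C^∞(·, G)`. -/
def H1.pullback {X Y : Type u} [DiffeologicalSpace X] [DiffeologicalSpace Y]
    (φ : Y → X) (hφ : DSmooth φ) : H1 G X →+ H1 G Y :=
  Cech.pullback φ hφ (smoothSheaf G X) 1

end SmoothSheaf
/-! ### Principal bundles -/

/-- A (right) principal `G`-bundle over `X`: a diffeological space with a smooth right action of `G`
and quotient map `proj` to `X`, such that `(p, g) ↦ (p, p · g)` is a diffeomorphism from `P × G` to
the fibre product `P ×_X P`. -/
structure PrincipalBundle (G : Type v) [AddCommGroup G] [DiffeologicalSpace G]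
    (X : Type u) [DiffeologicalSpace X] where
  /-- the total space -/
  Total : Type (max u v)
  [diffeology : DiffeologicalSpace Total]
  /-- the projection -/
  proj : Total → X
  /-- the right action `p · g` -/
  act : Total → G → Total
  act_zero : ∀ p, act p 0 = p
  act_add : ∀ p g h, act p (g + h) = act (act p g) h
  smooth_act : DSmooth (fun z : Total × G => act z.1 z.2)
  /-- the fibres of the projection are the orbits of the action -/
  proj_eq_iff : ∀ p q, proj p = proj q ↔ ∃ g, act p g = q
  /-- `X` carries the quotient diffeology -/
  subduction : IsSubduction proj
  diffeomorphism : IsDiffeomorphism (fun z : Total × G =>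
    (⟨(z.1, act z.1 z.2), (proj_eq_iff _ _).2 ⟨z.2, rfl⟩⟩ :
      {w : Total × Total // proj w.1 = proj w.2}))

attribute [instance] PrincipalBundle.diffeology

namespace PrincipalBundle

variable {G : Type v} [AddCommGroup G] [DiffeologicalSpace G]
variable {X Y : Type u} [DiffeologicalSpace X] [DiffeologicalSpace Y]

/-- Two principal bundles over `X` are isomorphic if there is a `G`-equivariant diffeomorphism
between them that intertwines the projections to `X`. -/
def Isomorphic (P P' : PrincipalBundle G X) : Prop :=
  ∃ F : P.Total → P'.Total, IsDiffeomorphism F ∧ (∀ p g, F (P.act p g) = P'.act (F p) g) ∧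
    ∀ p, P'.proj (F p) = P.proj p

theorem Isomorphic.refl (P : PrincipalBundle G X) : P.Isomorphic P :=
  ⟨id, ⟨dSmooth_id, id, dSmooth_id, fun _ => rfl, fun _ => rfl⟩, fun _ _ => rfl, fun _ => rfl⟩

theorem Isomorphic.symm {P P' : PrincipalBundle G X} (h : P.Isomorphic P') : P'.Isomorphic P := by
  obtain ⟨F, ⟨hF, F', hF', hl, hr⟩, hact, hproj⟩ := h
  refine ⟨F', ⟨hF', F, hF, hr, hl⟩, fun p g => ?_, fun p => ?_⟩
  · rw [← hl (P.act (F' p) g), hact, hr p]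
  · rw [← hproj, hr p]

theorem Isomorphic.trans {P P' P'' : PrincipalBundle G X} (h : P.Isomorphic P')
    (h' : P'.Isomorphic P'') : P.Isomorphic P'' := by
  obtain ⟨F, ⟨hF, F', hF', hl, hr⟩, hact, hproj⟩ := h
  obtain ⟨E, ⟨hE, E', hE', kl, kr⟩, kact, kproj⟩ := h'
  exact ⟨E ∘ F, ⟨hE.comp hF, F' ∘ E', hF'.comp hE', fun p => (congrArg F' (kl _)).trans (hl p),
      fun p => (congrArg E (hr _)).trans (kr p)⟩,
    fun p g => (congrArg E (hact p g)).trans (kact _ _), fun p => (kproj _).trans (hproj p)⟩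

instance setoid (G : Type v) [AddCommGroup G] [DiffeologicalSpace G]
    (X : Type u) [DiffeologicalSpace X] : Setoid (PrincipalBundle G X) :=
  ⟨Isomorphic, Isomorphic.refl, Isomorphic.symm, Isomorphic.trans⟩

/-- The pullback bundle `φ^*P = P ×_X Y`. -/
def pullback (φ : Y → X) (hφ : DSmooth φ) (P : PrincipalBundle G X) : PrincipalBundle G Y where
  Total := {z : P.Total × Y // P.proj z.1 = φ z.2}
  proj z := z.1.2
  act z g := ⟨(P.act z.1.1 g, z.1.2), ((P.proj_eq_iff _ _).2 ⟨g, rfl⟩).symm.trans z.2⟩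
  act_zero z := Subtype.ext (Prod.ext (P.act_zero _) rfl)
  act_add z g h := Subtype.ext (Prod.ext (P.act_add _ _ _) rfl)
  smooth_act n p hp := by
    refine ⟨?_, hp.1.2⟩
    exact P.smooth_act n (fun y => ((p y).1.1.1, (p y).2)) ⟨hp.1.1, hp.2⟩
  proj_eq_iff := by
    rintro ⟨⟨p, y⟩, hp⟩ ⟨⟨q, y'⟩, hq⟩
    constructor
    · rintro rfl
      obtain ⟨g, hg⟩ := (P.proj_eq_iff p q).1 (hp.trans hq.symm)
      exact ⟨g, Subtype.ext (Prod.ext hg rfl)⟩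
    · rintro ⟨g, hg⟩
      exact congrArg (fun z => z.1.2) hg
  subduction := by
    refine ⟨fun n p hp => hp.2, fun y => ?_, fun p x => ?_⟩
    · obtain ⟨q, hq⟩ := P.subduction.2.1 (φ y)
      exact ⟨⟨(q, y), hq⟩, rfl⟩
    · obtain ⟨V, hV, hx, q, hq, H⟩ := P.subduction.2.2 (p.map φ hφ) x
      exact ⟨V, hV, hx, fun y => ⟨(q y, p.toFun ⟨y, hV y.2⟩), H y⟩,
        fun n r hr => ⟨hq n r hr, (p.restrict V hV).smooth n r hr⟩, fun _ => rfl⟩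
  diffeomorphism := by
    obtain ⟨-, D, hD, hl, hr⟩ := P.diffeomorphism
    refine ⟨fun n p hp => ⟨hp.1, ?_, hp.1.2⟩, fun w => (w.1.1,
      (D ⟨(w.1.1.1.1, w.1.2.1.1), ?_⟩).2), fun n p hp => ⟨hp.1, ?_⟩, ?_, ?_⟩
    · exact P.smooth_act n (fun y => ((p y).1.1.1, (p y).2)) ⟨hp.1.1, hp.2⟩
    · exact w.1.1.2.trans ((congrArg φ w.2).trans w.1.2.2.symm)
    · exact (hD n (fun y => ⟨((p y).1.1.1.1, (p y).1.2.1.1),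
        (p y).1.1.2.trans ((congrArg φ (p y).2).trans (p y).1.2.2.symm)⟩)
        ⟨hp.1.1, hp.2.1⟩).2
    · rintro ⟨⟨⟨p, y⟩, hp⟩, g⟩
      have h := congrArg Prod.snd (hl (p, g))
      exact Prod.ext rfl h
    · rintro ⟨⟨⟨⟨p, y⟩, hp⟩, ⟨⟨q, y'⟩, hq⟩⟩, h⟩
      obtain rfl : y = y' := h
      have h1 := hr ⟨(p, q), hp.trans hq.symm⟩
      have h2 : (D ⟨(p, q), hp.trans hq.symm⟩).1 = p := congrArg (fun w => w.1.1) h1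
      have h3 := congrArg (fun w => w.1.2) h1
      simp only [h2] at h3
      exact Subtype.ext (Prod.ext rfl (Subtype.ext (Prod.ext h3 rfl)))

theorem Isomorphic.pullback (φ : Y → X) (hφ : DSmooth φ) {P P' : PrincipalBundle G X}
    (h : P.Isomorphic P') : (P.pullback φ hφ).Isomorphic (P'.pullback φ hφ) := by
  obtain ⟨F, ⟨hF, F', hF', hl, hr⟩, hact, hproj⟩ := h
  have hproj' : ∀ q, P.proj (F' q) = P'.proj q := fun q => by rw [← hproj, hr q]
  refine ⟨fun z => ⟨(F z.1.1, z.1.2), (hproj _).trans z.2⟩,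
    ⟨fun n p hp => ⟨hF n _ hp.1, hp.2⟩, fun z => ⟨(F' z.1.1, z.1.2), (hproj' _).trans z.2⟩,
      fun n p hp => ⟨hF' n _ hp.1, hp.2⟩, fun z => Subtype.ext (Prod.ext (hl _) rfl),
      fun z => Subtype.ext (Prod.ext (hr _) rfl)⟩,
    fun z g => Subtype.ext (Prod.ext (hact _ _) rfl), fun _ => rfl⟩

end PrincipalBundle

/-- The isomorphism classes of principal `G`-bundles over `X`. -/
def BundleClasses (G : Type v) [AddCommGroup G] [DiffeologicalSpace G]
    (X : Type u) [DiffeologicalSpace X] :=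
  Quotient (PrincipalBundle.setoid G X)

/-- The pullback of isomorphism classes along a smooth map, `[P] ↦ [φ^*P]`. -/
def BundleClasses.pullback {G : Type v} [AddCommGroup G] [DiffeologicalSpace G]
    {X Y : Type u} [DiffeologicalSpace X] [DiffeologicalSpace Y] (φ : Y → X) (hφ : DSmooth φ) :
    BundleClasses G X → BundleClasses G Y :=
  Quotient.map (PrincipalBundle.pullback φ hφ) fun _ _ h => h.pullback φ hφ

end DiffCech

end

open Diffeology DiffCech

/-! A principal bundle need not be locally trivial over `X`, but its pullback to the nebula of a
suitable generating family has a smooth section, because plots of `X` lift locally along the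
subduction `proj`. The class of the bundle is read off from such a section.

Well-definedness. Let `s` be a smooth lift of `ev` to the total space `P`. On `N(Q)_1` the points `s
x₀` and `s x₁` lie in one fibre, so they differ by a unique element of `G`. It depends smoothly on
the pair since `(p, g) ↦ (p, p · g)` has a smooth inverse. This is a Čech 1-cocycle. Two sections
over the same nebula differ by a smooth `G`-valued function, whose coboundary is the difference of
their cocycles. Sections over different families are compared on a common refinement
(`NebulaSection.cohClass_eq`).

Injectivity. If two classes agree, then on some refinement the cocycles differ by the coboundary of
a function `b`. Translating one section by `b` makes the cocycles equal. With equal cocycles, the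
rule `s x · g ↦ t x · g` is independent of `x` and defines an isomorphism (`glue_eq`,
`isomorphic_of_cohClass_eq`).

Surjectivity. The expected bundle of a cocycle `c` is the quotient of `N(Q) × G` by the
identifications that `c` prescribes. A set-theoretic section `σ` of `ev` gives a normal form for
each class, so the quotient is modelled on the set `X × G`. Its diffeology is defined by testing the
group coordinate along smooth lifts to the nebula. There the non-smooth choice `σ` enters only
through `shift`, whose differences over `X` are values of `c` (`shift_sub_shift`). The universal
section has cocycle exactly `c` (`transition_bundleSection`).

Naturality. A section pulls back along a map of generating families over `φ`, and its cocycle pulls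
back with it (`NebulaSection.cohClass_pullback`).

All cochain computations take place with ordinary smooth functions on `N(Q)_k`, because a global
section of the pulled back sheaf is determined by its values at points (`section_apply`). -/

noncomputable section

namespace DiffCech

/-! ### Local lifts to nebulae -/

section Lifts

variable {X : Type u} [DiffeologicalSpace X]

/-- A global plot, as an object of the category of plots. -/
def Plot.ofIsPlot {n : ℕ} (p : EuclideanSpace ℝ (Fin n) → X) (hp : IsPlot p) : Plot X where
  dim := n
  dom := ⊤
  toFun y := p y.1
  smooth m g hg := hp.dSmooth m (fun z => (g z).1) hg

theorem dSmooth_nebula_mk (Q : GenFam X) (q : Q.plots) :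
    DSmooth (fun y : q.1.dom => (⟨q, y⟩ : Nebula Q)) := by
  intro n p hp x _
  exact ⟨⊤, trivial, q, fun y => p y.1, fun m g hg => hp.dSmooth m (fun z => (g z).1) hg,
    fun _ => rfl⟩

/-- Every plot of `X` lifts locally to the nebula. -/
theorem exists_lift_nebula (Q : GenFam X) (p : Plot X) (x : p.dom) :
    ∃ (V : Opens (EuclideanSpace ℝ (Fin p.dim))) (hV : V ≤ p.dom), x.1 ∈ V ∧
      ∃ l : V → Nebula Q, DSmooth l ∧ ∀ y : V, ev Q (l y) = p.toFun ⟨y, hV y.2⟩ := by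
  obtain ⟨V, hV, hx, q, hq, ⟨f⟩⟩ := Q.generates p x
  exact ⟨V, hV, hx, fun y => ⟨⟨q, hq⟩, f.toFun y⟩,
    (dSmooth_nebula_mk Q ⟨q, hq⟩).comp f.smooth, fun y => f.comm y⟩

/-- A point is a zero-dimensional plot, and this plot too must factor through the family. -/
theorem ev_surjective (Q : GenFam X) : Function.Surjective (ev Q) := by
  intro x
  obtain ⟨V, hV, hx, l, -, hl⟩ := exists_lift_nebula Q
    (Plot.ofIsPlot (n := 0) (fun _ => x) isPlot_const) ⟨0, trivial⟩
  exact ⟨l ⟨_, hx⟩, hl _⟩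

/-- Being a plot can be tested along reparametrizations that lift to the nebula. -/
theorem isPlot_of_lift {Z : Type w} [DiffeologicalSpace Z] (Q : GenFam X) {n : ℕ}
    {p : EuclideanSpace ℝ (Fin n) → X} (hp : IsPlot p) {f : EuclideanSpace ℝ (Fin n) → Z}
    (H : ∀ (m : ℕ) (g : EuclideanSpace ℝ (Fin m) → EuclideanSpace ℝ (Fin n)),
      ContDiff ℝ ∞ g → ∀ l : EuclideanSpace ℝ (Fin m) → Nebula Q, IsPlot l →
        (∀ z, ev Q (l z) = p (g z)) → IsPlot (f ∘ g)) : IsPlot f := by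
  -- Near each point `p` lifts to the nebula on an open set `V`. Any smooth `g` into `V` then comes
  -- with the lift `l ∘ g`, so the hypothesis covers exactly what locality asks for.
  refine DiffeologicalSpace.locality fun x => ?_
  obtain ⟨V, hV, hx, l, hl, hlp⟩ := exists_lift_nebula Q (Plot.ofIsPlot p hp) ⟨x, trivial⟩
  refine ⟨V.1, V.2, hx, fun {m g} hgV hg => ?_⟩
  exact H m g hg (fun z => l ⟨g z, hgV z⟩) (hl m (fun z => ⟨g z, hgV z⟩) hg.isPlot)
    fun z => hlp ⟨g z, hgV z⟩

end Lifts

/-! ### Smooth maps into an abelian diffeological group -/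

section Smooth

variable {G : Type v} [AddCommGroup G] [DiffeologicalSpace G] [DiffeologicalAddCommGroup G]
variable {U : Type w} [DiffeologicalSpace U]

theorem DSmooth.add {f g : U → G} (hf : DSmooth f) (hg : DSmooth g) :
    DSmooth (fun x => f x + g x) :=
  (smoothMaps G U).add_mem hf hg

theorem DSmooth.sub {f g : U → G} (hf : DSmooth f) (hg : DSmooth g) :
    DSmooth (fun x => f x - g x) :=
  (smoothMaps G U).sub_mem hf hg

theorem IsPlot.add {n : ℕ} {f g : EuclideanSpace ℝ (Fin n) → G} (hf : IsPlot f) (hg : IsPlot g) :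
    IsPlot (fun x => f x + g x) :=
  (DSmooth.add hf.dSmooth hg.dSmooth).isPlot

theorem IsPlot.sub {n : ℕ} {f g : EuclideanSpace ℝ (Fin n) → G} (hf : IsPlot f) (hg : IsPlot g) :
    IsPlot (fun x => f x - g x) :=
  (DSmooth.sub hf.dSmooth hg.dSmooth).isPlot

end Smooth

/-! ### Global sections of the pulled back sheaf of smooth maps -/

section Value

variable {X : Type u} [DiffeologicalSpace X]
variable {G : Type v} [AddCommGroup G] [DiffeologicalSpace G] [DiffeologicalAddCommGroup G]
variable {Z : Type w} [DiffeologicalSpace Z]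

/-- The zero-dimensional plot at a point. -/
def Plot.point (z : Z) : Plot Z := Plot.ofIsPlot (n := 0) (fun _ => z) isPlot_const

/-- The value of a global section at a point. -/
def value (a : Z → X) (ha : DSmooth a)
    (η : globalSections ((smoothSheaf G X).pullback a ha)) (z : Z) : G :=
  ((η.1 (Plot.point z)).1 : (Plot.point z).dom → G) ⟨0, trivial⟩

/-- A point `y` of the domain of `p` is a morphism from the zero-dimensional plot at `p y` to `p`.
Coherence of `η` along it identifies `η p` at `y` with a quantity that depends only on the point `p
y` of `Z`. -/
theorem section_apply (a : Z → X) (ha : DSmooth a)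
    (η : globalSections ((smoothSheaf G X).pullback a ha)) (p : Plot Z) (y : p.dom) :
    ((η.1 p).1 : p.dom → G) y = value a ha η (p.toFun y) := by
  have h := η.2 (Plot.point (p.toFun y)) p ⟨fun _ => y, dSmooth_const, fun _ => rfl⟩
  exact congrArg (fun s : smoothMaps G (Plot.point (p.toFun y)).dom => s.1 ⟨0, trivial⟩) h

/-- Composed with a plot `p`, the value function is the component of `η` at `p`, which is smooth
because it is an element of the sheaf. -/
theorem dSmooth_value (a : Z → X) (ha : DSmooth a)
    (η : globalSections ((smoothSheaf G X).pullback a ha)) : DSmooth (value a ha η) := by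
  intro n p hp
  have h1 : DSmooth ((η.1 (Plot.ofIsPlot p hp)).1 : (Plot.ofIsPlot p hp).dom → G) :=
    (η.1 (Plot.ofIsPlot p hp)).2
  have h2 := h1 n (fun y => ⟨y, trivial⟩) (isPlot_id (n := n))
  have h3 : value a ha η ∘ p =
      ((η.1 (Plot.ofIsPlot p hp)).1 : (Plot.ofIsPlot p hp).dom → G) ∘ fun y => ⟨y, trivial⟩ :=
    funext fun y => (section_apply a ha η (Plot.ofIsPlot p hp) ⟨y, trivial⟩).symm
  rw [h3]
  exact h2

theorem value_injective (a : Z → X) (ha : DSmooth a)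
    {η μ : globalSections ((smoothSheaf G X).pullback a ha)}
    (h : ∀ z, value a ha η z = value a ha μ z) : η = μ := by
  refine Subtype.ext (funext fun p => Subtype.ext (funext fun y => ?_))
  exact (section_apply a ha η p y).trans ((h _).trans (section_apply a ha μ p y).symm)

/-- The global section given by a smooth map. -/
def sectionOf (a : Z → X) (ha : DSmooth a) (c : Z → G) (hc : DSmooth c) :
    globalSections ((smoothSheaf G X).pullback a ha) :=
  ⟨fun p => (⟨c ∘ p.toFun, hc.comp p.smooth⟩ : smoothMaps G p.dom), fun _ _ f =>
    Subtype.ext (funext fun y => congrArg c (f.comm y))⟩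

end Value

/-! ### Cochains of low degree as smooth maps -/

section Cochains

variable {X : Type u} [DiffeologicalSpace X]
variable {G : Type v} [AddCommGroup G] [DiffeologicalSpace G] [DiffeologicalAddCommGroup G]
variable {Q : GenFam X}

/-- The smooth map on the nerve that corresponds to a cochain. -/
def cochainValue {k : ℕ} (η : Cochain Q (smoothSheaf G X) k) (x : Nerve Q k) : G :=
  value (evk Q k) (dSmooth_evk Q k) η x

theorem dSmooth_cochainValue {k : ℕ} (η : Cochain Q (smoothSheaf G X) k) :
    DSmooth (cochainValue η) :=
  dSmooth_value _ _ η

theorem cochain_ext {k : ℕ} {η μ : Cochain Q (smoothSheaf G X) k}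
    (h : ∀ x, cochainValue η x = cochainValue μ x) : η = μ :=
  value_injective _ _ h

/-- The cochain that corresponds to a smooth map on the nerve. -/
def cochainOf {k : ℕ} (c : Nerve Q k → G) (hc : DSmooth c) : Cochain Q (smoothSheaf G X) k :=
  sectionOf _ _ c hc

theorem cochainValue_cochainOf {k : ℕ} (c : Nerve Q k → G) (hc : DSmooth c) (x : Nerve Q k) :
    cochainValue (cochainOf c hc) x = c x := rfl

/-- The constant point `x` of `N(Q)_0`. -/
def Nerve.single (x : Nebula Q) : Nerve Q 0 := ⟨fun _ => x, fun _ _ => rfl⟩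

/-- The point `(x, y)` of `N(Q)_1`. -/
def Nerve.pair (x y : Nebula Q) (h : ev Q x = ev Q y) : Nerve Q 1 :=
  ⟨![x, y], by simp [Fin.forall_fin_two, h]⟩

theorem Nerve.pair_eta (x : Nerve Q 1) : Nerve.pair (x.1 0) (x.1 1) (x.2 0 1) = x := by
  refine Subtype.ext (funext fun i => ?_)
  fin_cases i <;> rfl

theorem Nerve.isPlot_pair {n : ℕ} {x y : EuclideanSpace ℝ (Fin n) → Nebula Q} (hx : IsPlot x)
    (hy : IsPlot y) (h : ∀ z, ev Q (x z) = ev Q (y z)) :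
    IsPlot (fun z => Nerve.pair (x z) (y z) (h z)) := by
  intro i
  fin_cases i
  · exact hx
  · exact hy

/-- This fixes the sign convention: the face with sign `+` drops entry `0` and so leaves `x₁`. -/
theorem cochainValue_coboundary_zero (b : Cochain Q (smoothSheaf G X) 0) (x : Nerve Q 1) :
    cochainValue (coboundary Q (smoothSheaf G X) 0 b) x =
      cochainValue b (Nerve.single (x.1 1)) - cochainValue b (Nerve.single (x.1 0)) := by
  have h : coboundary Q (smoothSheaf G X) 0 b =
      faceMap Q (smoothSheaf G X) 0 0 b - faceMap Q (smoothSheaf G X) 0 1 b := by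
    simp [coboundary, Fin.sum_univ_two, sub_eq_add_neg]
  rw [h]
  have e0 : face Q 0 0 x = Nerve.single (x.1 1) :=
    Subtype.ext (funext fun i => by fin_cases i; rfl)
  have e1 : face Q 0 1 x = Nerve.single (x.1 0) :=
    Subtype.ext (funext fun i => by fin_cases i; rfl)
  rw [← e0, ← e1]
  rfl

theorem cochainValue_coboundary_one (c : Cochain Q (smoothSheaf G X) 1) (x : Nerve Q 2) :
    cochainValue (coboundary Q (smoothSheaf G X) 1 c) x =
      cochainValue c (Nerve.pair (x.1 1) (x.1 2) (x.2 1 2))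
        - cochainValue c (Nerve.pair (x.1 0) (x.1 2) (x.2 0 2))
        + cochainValue c (Nerve.pair (x.1 0) (x.1 1) (x.2 0 1)) := by
  have h : coboundary Q (smoothSheaf G X) 1 c =
      faceMap Q (smoothSheaf G X) 1 0 c - faceMap Q (smoothSheaf G X) 1 1 c
        + faceMap Q (smoothSheaf G X) 1 2 c := by
    simp [coboundary, Fin.sum_univ_three, sub_eq_add_neg]
  rw [h]
  have e0 : face Q 1 0 x = Nerve.pair (x.1 1) (x.1 2) (x.2 1 2) :=
    Subtype.ext (funext fun i => by fin_cases i <;> rfl)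
  have e1 : face Q 1 1 x = Nerve.pair (x.1 0) (x.1 2) (x.2 0 2) :=
    Subtype.ext (funext fun i => by fin_cases i <;> rfl)
  have e2 : face Q 1 2 x = Nerve.pair (x.1 0) (x.1 1) (x.2 0 1) :=
    Subtype.ext (funext fun i => by fin_cases i <;> rfl)
  rw [← e0, ← e1, ← e2]
  rfl

/-- The cocycle identity. -/
theorem cocycle_add (c : cocycles Q (smoothSheaf G X) 1) {x y z : Nebula Q}
    (hxy : ev Q x = ev Q y) (hyz : ev Q y = ev Q z) (hxz : ev Q x = ev Q z) :
    cochainValue c.1 (Nerve.pair x y hxy) + cochainValue c.1 (Nerve.pair y z hyz) =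
      cochainValue c.1 (Nerve.pair x z hxz) := by
  have h0 : coboundary Q (smoothSheaf G X) 1 c.1 = 0 := c.2
  have h := cochainValue_coboundary_one c.1
    ⟨![x, y, z], fun i j => by fin_cases i <;> fin_cases j <;> simp [hxy, hyz]⟩
  rw [h0] at h
  have h' : (0 : G) = cochainValue c.1 (Nerve.pair y z hyz)
      - cochainValue c.1 (Nerve.pair x z hxz) + cochainValue c.1 (Nerve.pair x y hxy) := h
  rw [eq_comm, ← sub_eq_zero]
  rw [eq_comm, ← neg_eq_zero] at h'
  rw [← h']
  abel

/-- The cocycle given by a smooth map on `N(Q)_1` that satisfies the cocycle identity. -/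
def cocycleOf (c : Nerve Q 1 → G) (hc : DSmooth c)
    (h : ∀ (x y z : Nebula Q) (hxy : ev Q x = ev Q y) (hyz : ev Q y = ev Q z),
      c (Nerve.pair x y hxy) + c (Nerve.pair y z hyz) = c (Nerve.pair x z (hxy.trans hyz))) :
    cocycles Q (smoothSheaf G X) 1 :=
  ⟨cochainOf c hc, by
    refine cochain_ext (Q := Q) fun x => ?_
    rw [cochainValue_coboundary_one, cochainValue_cochainOf, cochainValue_cochainOf,
      cochainValue_cochainOf, ← h _ _ _ (x.2 0 1) (x.2 1 2)]
    change _ = (0 : G)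
    abel⟩

/-- Two cocycles are cohomologous if and only if they differ by the coboundary of a smooth map on
the nebula. -/
theorem mk_eq_mk_iff {c d : cocycles Q (smoothSheaf G X) 1} :
    CechFam.mk Q (smoothSheaf G X) 1 c = CechFam.mk Q (smoothSheaf G X) 1 d ↔
      ∃ b : Nebula Q → G, DSmooth b ∧ ∀ x : Nerve Q 1,
        cochainValue d.1 x - cochainValue c.1 x = b (x.1 1) - b (x.1 0) := by
  rw [CechFam.mk_eq_mk]
  constructor
  · rintro ⟨b, hb⟩
    refine ⟨fun x => cochainValue b (Nerve.single x),
      (dSmooth_cochainValue b).comp fun n p hp _ => hp, fun x => ?_⟩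
    rw [← cochainValue_coboundary_zero, hb]
    rfl
  · rintro ⟨b, hb, h⟩
    refine ⟨cochainOf (fun x => b (x.1 0)) fun n p hp => hb n _ (hp 0), ?_⟩
    refine cochain_ext fun x => ?_
    rw [cochainValue_coboundary_zero]
    exact (h x).symm

end Cochains

/-! ### Sections of a principal bundle over a nebula and their transition cocycles -/

namespace PrincipalBundle

variable {G : Type v} [AddCommGroup G] [DiffeologicalSpace G]
variable {X Y : Type u} [DiffeologicalSpace X] [DiffeologicalSpace Y]
variable (P : PrincipalBundle G X)

/-- The element of `G` that carries one point of a fibre to another. -/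
def diff (p q : P.Total) (h : P.proj p = P.proj q) : G :=
  (P.diffeomorphism.2.choose ⟨(p, q), h⟩).2

theorem diff_act (p : P.Total) (g : G) (h : P.proj p = P.proj (P.act p g)) :
    P.diff p (P.act p g) h = g :=
  congrArg Prod.snd (P.diffeomorphism.2.choose_spec.2.1 (p, g))

theorem proj_act (p : P.Total) (g : G) : P.proj (P.act p g) = P.proj p :=
  ((P.proj_eq_iff _ _).2 ⟨g, rfl⟩).symm

theorem act_diff (p q : P.Total) (h : P.proj p = P.proj q) : P.act p (P.diff p q h) = q := by
  obtain ⟨g, rfl⟩ := (P.proj_eq_iff p q).1 h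
  rw [P.diff_act]

/-- The action is free. Identities between values of `diff` are proved by checking that the proposed
element carries the first point to the second. -/
theorem diff_eq_of_act {p q : P.Total} {g : G} (h : P.proj p = P.proj q) (hg : P.act p g = q) :
    P.diff p q h = g := by
  subst hg
  exact P.diff_act _ _ _

theorem diff_add_diff {p q r : P.Total} (h : P.proj p = P.proj q) (h' : P.proj q = P.proj r) :
    P.diff p q h + P.diff q r h' = P.diff p r (h.trans h') :=
  (P.diff_eq_of_act _ (by rw [P.act_add, P.act_diff, P.act_diff])).symm

theorem diff_act_right (p q : P.Total) (h : P.proj p = P.proj q) (g : G) :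
    P.diff p (P.act q g) (h.trans (P.proj_act q g).symm) = P.diff p q h + g :=
  P.diff_eq_of_act _ (by rw [P.act_add, P.act_diff])

/-- The difference is the second component of the inverse of `(p, g) ↦ (p, p · g)`, so its
smoothness is what the diffeomorphism axiom provides. Smoothness of transition functions rests on
it. -/
theorem isPlot_diff {n : ℕ} {p q : EuclideanSpace ℝ (Fin n) → P.Total} (hp : IsPlot p)
    (hq : IsPlot q) (h : ∀ z, P.proj (p z) = P.proj (q z)) :
    IsPlot (fun z => P.diff (p z) (q z) (h z)) :=
  (P.diffeomorphism.2.choose_spec.1 n (fun z => ⟨(p z, q z), h z⟩) ⟨hp, hq⟩).2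

theorem isPlot_act {n : ℕ} {p : EuclideanSpace ℝ (Fin n) → P.Total}
    {g : EuclideanSpace ℝ (Fin n) → G} (hp : IsPlot p) (hg : IsPlot g) :
    IsPlot (fun z => P.act (p z) (g z)) :=
  P.smooth_act n (fun z => (p z, g z)) ⟨hp, hg⟩

/-- A smooth map from the nebula of a generating family to the total space of a principal bundle
that lifts the evaluation map. -/
structure NebulaSection (Q : GenFam X) where
  /-- the underlying map -/
  toFun : Nebula Q → P.Total
  smooth : DSmooth toFun
  proj_toFun : ∀ x, P.proj (toFun x) = ev Q x

/-- The generating family of all plots of the base that lift to the total space. -/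
def liftableFam : GenFam X where
  plots := {q | ∃ s : q.dom → P.Total, DSmooth s ∧ ∀ y, P.proj (s y) = q.toFun y}
  generates p x := by
    obtain ⟨V, hV, hx, s, hs, h⟩ := P.subduction.2.2 p x
    exact ⟨V, hV, hx, p.restrict V hV, ⟨s, hs, h⟩, ⟨𝟙 _⟩⟩

/-- A section over the nebula of the family of liftable plots. -/
def liftableSection : P.NebulaSection P.liftableFam where
  toFun x := x.1.2.choose x.2
  smooth n p hp := by
    -- The lift is chosen once for each plot `q` of the family. A plot of the nebula locally stays
    -- in a single summand, so there the map is one chosen smooth lift composed with a smooth map.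
    refine DiffeologicalSpace.locality fun x => ?_
    obtain ⟨V, hV, q, r, hr, H⟩ := hp x trivial
    refine ⟨V, V.2, hV, fun {m f} hfV hf => ?_⟩
    have h1 := (q.2.choose_spec.1.comp hr) m (fun z => ⟨f z, hfV z⟩) hf.isPlot
    have h2 : ((fun x : Nebula P.liftableFam => x.1.2.choose x.2) ∘ p) ∘ f =
        (q.2.choose ∘ r) ∘ fun z => ⟨f z, hfV z⟩ := by
      funext z
      change (fun x : Nebula P.liftableFam => x.1.2.choose x.2) (p (f z)) = _
      rw [H ⟨f z, hfV z⟩]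
      rfl
    rw [h2]
    exact h1
  proj_toFun x := x.1.2.choose_spec.2 x.2

namespace NebulaSection

variable {P} {Q R : GenFam X} (s : P.NebulaSection Q)

theorem proj_eq {x y : Nebula Q} (h : ev Q x = ev Q y) :
    P.proj (s.toFun x) = P.proj (s.toFun y) := by
  rw [s.proj_toFun, s.proj_toFun, h]

/-- The restriction of a section along a refinement. -/
def refine (f : Refinement Q R) : P.NebulaSection R where
  toFun x := s.toFun (f.nebulaMap x)
  smooth := s.smooth.comp f.dSmooth_nebulaMap
  proj_toFun x := (s.proj_toFun _).trans (f.ev_nebulaMap x)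

/-- The image of a section under an equivariant map. -/
def map {P' : PrincipalBundle G X} (F : P.Total → P'.Total) (hF : DSmooth F)
    (hproj : ∀ a, P'.proj (F a) = P.proj a) : P'.NebulaSection Q where
  toFun x := F (s.toFun x)
  smooth := hF.comp s.smooth
  proj_toFun x := (hproj _).trans (s.proj_toFun x)

/-- The pullback of a section along a map of generating families. -/
def pullback {φ : Y → X} {hφ : DSmooth φ} {R : GenFam Y} (f : FamMap φ hφ Q R) :
    (P.pullback φ hφ).NebulaSection R where
  toFun x := ⟨(s.toFun (f.nebulaMap x), ev R x), (s.proj_toFun _).trans (f.ev_nebulaMap x)⟩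
  smooth n _ hp := ⟨s.smooth n _ (f.dSmooth_nebulaMap n _ hp), dSmooth_ev R n _ hp⟩
  proj_toFun _ := rfl

/-- The translate of a section by a smooth map into the group. -/
def translate (b : Nebula Q → G) (hb : DSmooth b) : P.NebulaSection Q where
  toFun x := P.act (s.toFun x) (b x)
  smooth n p hp := P.isPlot_act (s.smooth n p hp) (hb n p hp)
  proj_toFun x := (P.proj_act _ _).trans (s.proj_toFun x)

variable [DiffeologicalAddCommGroup G]

/-- The transition cocycle of a section. -/
def transition : cocycles Q (smoothSheaf G X) 1 :=
  cocycleOf (fun x => P.diff (s.toFun (x.1 0)) (s.toFun (x.1 1)) (s.proj_eq (x.2 0 1)))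
    (fun n _ hp => P.isPlot_diff (s.smooth n _ (hp 0)) (s.smooth n _ (hp 1)) _)
    fun _ _ _ hxy hyz => P.diff_add_diff (s.proj_eq hxy) (s.proj_eq hyz)

theorem transition_apply (x : Nerve Q 1) : cochainValue s.transition.1 x =
    P.diff (s.toFun (x.1 0)) (s.toFun (x.1 1)) (s.proj_eq (x.2 0 1)) := rfl

/-- The class of the transition cocycle. -/
def cohClass : H1 G X :=
  Cech.of (smoothSheaf G X) 1 Q (CechFam.mk Q (smoothSheaf G X) 1 s.transition)

/-- Both cocycles are the difference of `s` at the images of the two points in `N(Q)`, so they agree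
already as functions, before passing to classes. -/
theorem refMap_mk_transition (f : Refinement Q R) :
    f.refMap (smoothSheaf G X) 1 (CechFam.mk Q _ 1 s.transition) =
      CechFam.mk R _ 1 (s.refine f).transition := by
  refine (FamMap.cohMap_mk f _ 1 _).trans (congrArg (CechFam.mk R _ 1) (Subtype.ext ?_))
  exact cochain_ext (Q := R) fun x => rfl

theorem refineMap_mk_transition (h : Q ≤ R) (f : Refinement Q R) :
    refineMap (smoothSheaf G X) 1 Q R h (CechFam.mk Q _ 1 s.transition) =
      CechFam.mk R _ 1 (s.refine f).transition := by
  rw [refineMap, FamMap.refMap_eq _ f, refMap_mk_transition]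

theorem cohClass_refine (f : Refinement Q R) : (s.refine f).cohClass = s.cohClass := by
  rw [cohClass, ← s.refineMap_mk_transition ⟨f⟩ f, Cech.of_refineMap]
  rfl

/-- The class of the transition cocycle depends only on the bundle. -/
theorem cohClass_eq (t : P.NebulaSection R) : s.cohClass = t.cohClass := by
  obtain ⟨S, ⟨f⟩, ⟨g⟩⟩ := exists_ge_ge Q R
  rw [← s.cohClass_refine f, ← t.cohClass_refine g]
  generalize s.refine f = s'
  generalize t.refine g = t'
  refine congrArg (Cech.of _ 1 S) (mk_eq_mk_iff.2 ?_)
  have h : ∀ x, P.proj (s'.toFun x) = P.proj (t'.toFun x) := fun x => by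
    rw [s'.proj_toFun, t'.proj_toFun]
  -- The cobounding function is the difference of the two sections. The required identity compares
  -- the two routes from `s' x₀` to `t' x₁`, through `t' x₀` and through `s' x₁`.
  refine ⟨fun x => P.diff (s'.toFun x) (t'.toFun x) (h x),
    fun n p hp => P.isPlot_diff (s'.smooth n _ hp) (t'.smooth n _ hp) _, fun x => ?_⟩
  rw [transition_apply, transition_apply, sub_eq_sub_iff_add_eq_add, add_comm]
  exact (P.diff_add_diff (h _) (t'.proj_eq (x.2 0 1))).trans
    ((P.diff_add_diff (s'.proj_eq (x.2 0 1)) (h _)).symm.trans (add_comm _ _))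

/-- An equivariant map preserves differences within fibres, so the two transition cocycles are
equal, not merely cohomologous. -/
theorem cohClass_map {P' : PrincipalBundle G X} (F : P.Total → P'.Total) (hF : DSmooth F)
    (hproj : ∀ p, P'.proj (F p) = P.proj p) (hact : ∀ p g, F (P.act p g) = P'.act (F p) g) :
    (s.map F hF hproj).cohClass = s.cohClass := by
  refine congrArg (fun c => Cech.of _ 1 Q (CechFam.mk Q _ 1 c)) (Subtype.ext ?_)
  refine cochain_ext (Q := Q) fun x => ?_
  rw [transition_apply, transition_apply]
  refine P'.diff_eq_of_act _ ?_
  change P'.act (F _) _ = F _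
  rw [← hact, P.act_diff]

/-- The group acts on `P ×_X Y` through the first factor, so the transition function of the pulled
back section is that of `s` composed with the map of nerves induced by `f`. -/
theorem cohClass_pullback {φ : Y → X} {hφ : DSmooth φ} {R : GenFam Y} (f : FamMap φ hφ Q R) :
    (s.pullback f).cohClass = H1.pullback G φ hφ s.cohClass := by
  refine Eq.trans ?_ (Cech.pullback_of f (smoothSheaf G X) 1 _).symm
  rw [FamMap.cohMap_mk]
  refine congrArg (fun c => Cech.of (smoothSheaf G Y) 1 R (CechFam.mk R _ 1 c)) (Subtype.ext ?_)
  refine cochain_ext (Q := R) fun x => ?_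
  rw [transition_apply]
  refine PrincipalBundle.diff_eq_of_act _ _ (Subtype.ext (Prod.ext ?_ (x.2 0 1)))
  exact P.act_diff _ _ (s.proj_eq (x := f.nebulaMap (x.1 0)) (y := f.nebulaMap (x.1 1)) (by rw [f.ev_nebulaMap, f.ev_nebulaMap, x.2 0 1]))

end NebulaSection

end PrincipalBundle

/-- Two classes agree in the colimit if and only if they agree on a common refinement. -/
theorem Cech.exists_refineMap_eq {X : Type u} [DiffeologicalSpace X] {F : AbPresheaf.{u, v} X}
    {k : ℕ} {Q R : GenFam X} {c : CechFam Q F k} {d : CechFam R F k}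
    (h : Cech.of F k Q c = Cech.of F k R d) :
    ∃ (S : GenFam X) (hQ : Q ≤ S) (hR : R ≤ S), refineMap F k Q S hQ c = refineMap F k R S hR d :=
  Quotient.exact h

namespace PrincipalBundle

/-! ### Bundles with the same transition cocycle are isomorphic -/

section Glue

variable {G : Type v} [AddCommGroup G] [DiffeologicalSpace G]
variable {X : Type u} [DiffeologicalSpace X] {P P' : PrincipalBundle G X} {Q : GenFam X}

namespace NebulaSection

theorem ev_surjInv (Q : GenFam X) (x : X) : ev Q (Function.surjInv (ev_surjective Q) x) = x :=
  Function.surjInv_eq _ x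

/-- The equivariant map of total spaces that carries a section `s` to a section `t`. -/
def glue (s : P.NebulaSection Q) (t : P'.NebulaSection Q) (p : P.Total) : P'.Total :=
  P'.act (t.toFun (Function.surjInv (ev_surjective Q) (P.proj p)))
    (P.diff (s.toFun (Function.surjInv (ev_surjective Q) (P.proj p))) p
      ((s.proj_toFun _).trans (ev_surjInv Q _)))

/-- Two sections have the same transition functions. -/
def SameTransition (s : P.NebulaSection Q) (t : P'.NebulaSection Q) : Prop :=
  ∀ (x y : Nebula Q) (h : ev Q x = ev Q y),
    P.diff (s.toFun x) (s.toFun y) (s.proj_eq h) = P'.diff (t.toFun x) (t.toFun y) (t.proj_eq h)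

/-- The chosen point over `proj p` may be replaced by any other: passing between them changes the
base point in `P'` and the group element by the same transition value. This removes the arbitrary
choice in `glue`, after which smoothness and equivariance can be checked with convenient lifts. -/
theorem glue_eq {s : P.NebulaSection Q} {t : P'.NebulaSection Q} (h : s.SameTransition t)
    (p : P.Total) (x : Nebula Q) (hx : P.proj (s.toFun x) = P.proj p) :
    s.glue t p = P'.act (t.toFun x) (P.diff (s.toFun x) p hx) := by
  set y := Function.surjInv (ev_surjective Q) (P.proj p) with hy
  have hyp : P.proj (s.toFun y) = P.proj p := (s.proj_toFun _).trans (ev_surjInv Q _)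
  have hxy : ev Q x = ev Q y := by rw [← s.proj_toFun, ← s.proj_toFun, hx, hyp]
  change P'.act (t.toFun y) (P.diff (s.toFun y) p hyp) = _
  rw [← P.diff_add_diff (s.proj_eq hxy) hyp, h x y hxy, P'.act_add, P'.act_diff]

/-- The right inverse of `ev` used in `glue` is not smooth. Wherever the projected plot lifts
smoothly to the nebula, `glue_eq` computes the map with that lift instead. -/
theorem dSmooth_glue {s : P.NebulaSection Q} {t : P'.NebulaSection Q} (h : s.SameTransition t) :
    DSmooth (s.glue t) := by
  intro n p hp
  refine isPlot_of_lift Q (P.subduction.1 n p hp) fun m g hg l hl hlp => ?_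
  have hs : ∀ z, P.proj (s.toFun (l z)) = P.proj (p (g z)) := fun z =>
    (s.proj_toFun _).trans (hlp z)
  have e : (s.glue t ∘ p) ∘ g =
      fun z => P'.act (t.toFun (l z)) (P.diff (s.toFun (l z)) (p (g z)) (hs z)) :=
    funext fun z => glue_eq h _ _ _
  rw [e]
  exact P'.isPlot_act (t.smooth m l hl)
    (P.isPlot_diff (s.smooth m l hl) (isPlot_reparam hp hg) hs)

theorem proj_glue (s : P.NebulaSection Q) (t : P'.NebulaSection Q) (p : P.Total) :
    P'.proj (s.glue t p) = P.proj p :=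
  (P'.proj_act _ _).trans ((t.proj_toFun _).trans (ev_surjInv Q _))

theorem glue_act {s : P.NebulaSection Q} {t : P'.NebulaSection Q} (h : s.SameTransition t)
    (p : P.Total) (g : G) : s.glue t (P.act p g) = P'.act (s.glue t p) g := by
  obtain ⟨x, hx⟩ := ev_surjective Q (P.proj p)
  have hx' : P.proj (s.toFun x) = P.proj p := (s.proj_toFun x).trans hx
  rw [glue_eq h p x hx', glue_eq h (P.act p g) x (hx'.trans (P.proj_act p g).symm),
    P.diff_act_right _ _ hx', P'.act_add]

theorem glue_glue {s : P.NebulaSection Q} {t : P'.NebulaSection Q} (h : s.SameTransition t)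
    (p : P.Total) : t.glue s (s.glue t p) = p := by
  obtain ⟨x, hx⟩ := ev_surjective Q (P.proj p)
  have hx' : P.proj (s.toFun x) = P.proj p := (s.proj_toFun x).trans hx
  have ht : P'.proj (t.toFun x) = P'.proj (s.glue t p) := by rw [proj_glue, t.proj_toFun, hx]
  rw [glue_eq (fun x y e => (h x y e).symm) (s.glue t p) x ht,
    P'.diff_eq_of_act ht (glue_eq h p x hx').symm, P.act_diff]

theorem isomorphic_of_sameTransition {s : P.NebulaSection Q} {t : P'.NebulaSection Q}
    (h : s.SameTransition t) : P.Isomorphic P' :=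
  ⟨s.glue t, ⟨dSmooth_glue h, t.glue s, dSmooth_glue fun x y e => (h x y e).symm, glue_glue h,
    glue_glue fun x y e => (h x y e).symm⟩, glue_act h, proj_glue s t⟩

theorem isomorphic_of_cohClass_eq [DiffeologicalAddCommGroup G] {R : GenFam X}
    {s : P.NebulaSection Q} {t : P'.NebulaSection R} (h : s.cohClass = t.cohClass) :
    P.Isomorphic P' := by
  obtain ⟨S, hQS, hRS, e⟩ := Cech.exists_refineMap_eq h
  obtain ⟨f⟩ := id hQS
  obtain ⟨g⟩ := id hRS
  have e' := ((s.refineMap_mk_transition hQS f).symm.trans e).trans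
    (t.refineMap_mk_transition hRS g)
  -- Only the sections over the common refinement matter from here on.
  generalize s.refine f = s' at e'
  generalize t.refine g = t' at e'
  obtain ⟨b, hb, hbx⟩ := mk_eq_mk_iff.1 e'
  -- Translating by `b` adds `b y - b x` to the transition value at `(x, y)`, which is exactly the
  -- discrepancy between the two cocycles. Commutativity of `G` is used here.
  refine isomorphic_of_sameTransition (s := s'.translate b hb) (t := t') fun x y hxy => ?_
  have h1 := hbx (Nerve.pair x y hxy)
  rw [transition_apply, transition_apply] at h1
  have h2 : P'.diff (t'.toFun x) (t'.toFun y) (t'.proj_eq hxy) -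
      P.diff (s'.toFun x) (s'.toFun y) (s'.proj_eq hxy) = b y - b x := h1
  refine P.diff_eq_of_act _ ?_
  change P.act (P.act (s'.toFun x) (b x)) _ = P.act (s'.toFun y) (b y)
  rw [sub_eq_iff_eq_add.1 h2, ← P.act_add, ← add_assoc, add_sub_cancel, add_comm, P.act_add,
    P.act_diff]

end NebulaSection

end Glue

end PrincipalBundle

/-! ### The bundle of a cocycle -/

section Twisted

variable {G : Type v} [AddCommGroup G] [DiffeologicalSpace G] [DiffeologicalAddCommGroup G]
variable {X : Type u} [DiffeologicalSpace X] {Q : GenFam X}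

/-- The total space of the principal bundle of a cocycle `c`: the set `X × G`, where `(x, g)`
is the translate by `g` of the value at `σ x` of a universal section over the nebula, for a
set-theoretic section `σ` of the evaluation map. -/
@[ext]
structure TwistedProduct (c : cocycles Q (smoothSheaf G X) 1) : Type (max u v) where
  /-- the point of the base -/
  base : X
  /-- the coordinate in the group -/
  coord : G

namespace TwistedProduct

variable (c : cocycles Q (smoothSheaf G X) 1)

/-- The transition function from `y` to the chosen point of the nebula over `ev y`. -/
def shift (y : Nebula Q) : G :=
  cochainValue c.1 (Nerve.pair y (Function.surjInv (ev_surjective Q) (ev Q y))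
    (Function.surjInv_eq (ev_surjective Q) (ev Q y)).symm)

/-- Points over the same `x` are compared with the same chosen point `σ x`, so the cocycle identity
for `y`, `z`, `σ x` cancels the choice. Thus `shift` need not be smooth, but its differences over
`X` are. -/
theorem shift_sub_shift {y z : Nebula Q} (h : ev Q y = ev Q z) :
    shift c y - shift c z = cochainValue c.1 (Nerve.pair y z h) := by
  -- The chosen points over `ev y` and `ev z` are equal only after rewriting inside a dependent
  -- pair. Generalizing the base point to `w` permits substitution.
  have key : ∀ (w : X) (hw : w = ev Q z) (hz : ev Q z = ev Q (Function.surjInv (ev_surjective Q) w)),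
      cochainValue c.1 (Nerve.pair z _ hz) = shift c z := by
    rintro _ rfl _
    rfl
  rw [sub_eq_iff_eq_add, ← key (ev Q y) h (h.symm.trans
    (Function.surjInv_eq (ev_surjective Q) (ev Q y)).symm), cocycle_add]
  rfl

/-- The plots are the maps over plots of the base whose coordinates with respect to the local lifts
to the nebula are smooth. -/
instance : DiffeologicalSpace (TwistedProduct c) where
  plots n := {p | IsPlot (fun y => (p y).base) ∧
    ∀ (m : ℕ) (g : EuclideanSpace ℝ (Fin m) → EuclideanSpace ℝ (Fin n)), ContDiff ℝ ∞ g →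
      ∀ l : EuclideanSpace ℝ (Fin m) → Nebula Q, IsPlot l → (∀ z, ev Q (l z) = (p (g z)).base) →
        IsPlot (fun z => shift c (l z) + (p (g z)).coord)}
  constant_plots x := by
    refine ⟨isPlot_const, fun m g hg l hl h => ?_⟩
    refine IsPlot.add ?_ isPlot_const
    obtain ⟨y, hy⟩ := ev_surjective Q x.base
    -- All the points `l z` lie over one base point. Relative to a fixed `y` there, `shift c (l z)`
    -- is a cocycle value plus a constant, hence smooth.
    have e : (fun z => shift c (l z)) = fun z =>
        cochainValue c.1 (Nerve.pair (l z) y ((h z).trans hy.symm)) + shift c y := by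
      funext z
      rw [← shift_sub_shift, sub_add_cancel]
    rw [e]
    exact IsPlot.add (dSmooth_cochainValue c.1 m _
      (Nerve.isPlot_pair hl isPlot_const fun z => (h z).trans hy.symm)) isPlot_const
  plot_reparam hp hf := ⟨isPlot_reparam hp.1 hf, fun m g hg l hl h =>
    hp.2 m _ (hf.comp hg) l hl h⟩
  locality {n p} h := by
    constructor
    · refine DiffeologicalSpace.locality (p := fun y => (p y).base) fun x => ?_
      obtain ⟨u, hu, hx, H⟩ := h x
      exact ⟨u, hu, hx, fun hf hf' => (H hf hf').1⟩
    · intro m g hg l hl e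
      refine DiffeologicalSpace.locality fun x => ?_
      obtain ⟨u, hu, hx, H⟩ := h (g x)
      refine ⟨g ⁻¹' u, hu.preimage hg.continuous, hx, fun {k f} hf hf' => ?_⟩
      -- The reparametrization `g ∘ f` already maps into the small open set. The coordinate
      -- condition for `p ∘ g ∘ f` is then used with the identity as test map.
      exact (H hf (hg.comp hf')).2 k id contDiff_id (l ∘ f) (isPlot_reparam hl hf') fun z => e _

theorem isPlot_coord {n : ℕ} {p : EuclideanSpace ℝ (Fin n) → TwistedProduct c} (hp : IsPlot p)
    {m : ℕ} {g : EuclideanSpace ℝ (Fin m) → EuclideanSpace ℝ (Fin n)} (hg : ContDiff ℝ ∞ g)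
    {l : EuclideanSpace ℝ (Fin m) → Nebula Q} (hl : IsPlot l)
    (h : ∀ z, ev Q (l z) = (p (g z)).base) :
    IsPlot (fun z => shift c (l z) + (p (g z)).coord) :=
  hp.2 m g hg l hl h

/-- The universal section over the nebula. -/
def lift (y : Nebula Q) : TwistedProduct c := ⟨ev Q y, -shift c y⟩

/-- The coordinate of `lift c y` along a lift `l` is `shift c l - shift c y`, a value of the smooth
cocycle. This accounts for the sign in `lift`. -/
theorem dSmooth_lift : DSmooth (lift c) := by
  intro n p hp
  refine ⟨dSmooth_ev Q n p hp, fun m g hg l hl h => ?_⟩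
  have h' : ∀ z, ev Q (l z) = ev Q (p (g z)) := h
  have e : (fun z => shift c (l z) + ((lift c ∘ p) (g z)).coord) = fun z =>
      cochainValue c.1 (Nerve.pair (l z) (p (g z)) (h' z)) := by
    funext z
    rw [← shift_sub_shift c (h' z), sub_eq_add_neg]
    rfl
  rw [e]
  exact dSmooth_cochainValue c.1 m _ (Nerve.isPlot_pair hl (isPlot_reparam hp hg) h')

/-- The action of the group on the total space. -/
def act (p : TwistedProduct c) (g : G) : TwistedProduct c := ⟨p.base, p.coord + g⟩

theorem dSmooth_act : DSmooth (fun z : TwistedProduct c × G => act c z.1 z.2) := by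
  refine fun n p hp => ⟨hp.1.1, fun m g hg l hl h => ?_⟩
  have e : (fun z => shift c (l z) +
      (((fun z : TwistedProduct c × G => act c z.1 z.2) ∘ p) (g z)).coord) =
      fun z => (shift c (l z) + (p (g z)).1.coord) + (p (g z)).2 :=
    funext fun z => (add_assoc _ _ _).symm
  rw [e]
  exact IsPlot.add (isPlot_coord c hp.1 hg hl h) (isPlot_reparam hp.2 hg)

theorem base_eq_iff (p q : TwistedProduct c) : p.base = q.base ↔ ∃ g, act c p g = q := by
  constructor
  · intro h
    exact ⟨q.coord - p.coord, TwistedProduct.ext h (add_sub_cancel _ _)⟩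
  · rintro ⟨g, rfl⟩
    rfl

/-- Over a common base point both coordinates are tested with the same `shift` term, which cancels
in the difference. This gives smoothness of the inverse in the diffeomorphism axiom. -/
theorem isPlot_coord_sub_coord {n : ℕ} {p q : EuclideanSpace ℝ (Fin n) → TwistedProduct c}
    (hp : IsPlot p) (hq : IsPlot q) (h : ∀ z, (p z).base = (q z).base) :
    IsPlot (fun z => (q z).coord - (p z).coord) := by
  refine isPlot_of_lift Q hp.1 fun m g hg l hl e => ?_
  have e' : (fun z => (q z).coord - (p z).coord) ∘ g = fun z =>
      (shift c (l z) + (q (g z)).coord) - (shift c (l z) + (p (g z)).coord) :=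
    funext fun z => (add_sub_add_left_eq_sub _ _ _).symm
  rw [e']
  exact IsPlot.sub (isPlot_coord c hq hg hl fun z => (e z).trans (h _))
    (isPlot_coord c hp hg hl e)

/-- The principal bundle of a cocycle. -/
def bundle : PrincipalBundle G X where
  Total := TwistedProduct c
  proj := base
  act := act c
  act_zero p := TwistedProduct.ext rfl (add_zero _)
  act_add p g h := TwistedProduct.ext rfl (add_assoc _ _ _).symm
  smooth_act := dSmooth_act c
  proj_eq_iff := base_eq_iff c
  subduction := by
    refine ⟨fun n p hp => hp.1, fun x => ⟨⟨x, 0⟩, rfl⟩, fun p x => ?_⟩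
    obtain ⟨V, hV, hx, l, hl, h⟩ := exists_lift_nebula Q p x
    -- Plots of `X` lift to the nebula locally, and the universal section carries such lifts on to
    -- the total space. The set-theoretic section `x ↦ (x, 0)` above gives only surjectivity.
    exact ⟨V, hV, hx, lift c ∘ l, (dSmooth_lift c).comp hl, h⟩
  diffeomorphism := by
    refine ⟨fun n p hp => ⟨hp.1, dSmooth_act c n p hp⟩,
      fun w => (w.1.1, w.1.2.coord - w.1.1.coord),
      fun n p hp => ⟨hp.1, isPlot_coord_sub_coord c hp.1 hp.2 fun z => (p z).2⟩,
      fun z => Prod.ext rfl (add_sub_cancel_left _ _), fun w => Subtype.ext (Prod.ext rfl ?_)⟩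
    exact TwistedProduct.ext w.2 (add_sub_cancel _ _)

/-- The universal section, as a section of the bundle of a cocycle. -/
def bundleSection : (bundle c).NebulaSection Q where
  toFun := lift c
  smooth := dSmooth_lift c
  proj_toFun _ := rfl

/-- In the group coordinate, carrying `lift x₀` to `lift x₁` takes `shift x₀ - shift x₁`, which is
`c` at `(x₀, x₁)`. -/
theorem transition_bundleSection : (bundleSection c).transition = c := by
  refine Subtype.ext (cochain_ext fun x => ?_)
  rw [PrincipalBundle.NebulaSection.transition_apply]
  refine (bundle c).diff_eq_of_act _ (TwistedProduct.ext (x.2 0 1) ?_)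
  change -shift c (x.1 0) + cochainValue c.1 x = -shift c (x.1 1)
  rw [← Nerve.pair_eta x, ← shift_sub_shift]
  change -shift c (x.1 0) + (shift c (x.1 0) - shift c (x.1 1)) = _
  abel

end TwistedProduct

end Twisted

/-! ### The classification -/

section Classification

variable (G : Type v) [AddCommGroup G] [DiffeologicalSpace G] [DiffeologicalAddCommGroup G]

namespace PrincipalBundle

/-- The cohomology class of a principal bundle. -/
def cohClass {G : Type v} [AddCommGroup G] [DiffeologicalSpace G] [DiffeologicalAddCommGroup G]
    {X : Type u} [DiffeologicalSpace X] (P : PrincipalBundle G X) : H1 G X :=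
  P.liftableSection.cohClass

variable {G} {X : Type u} [DiffeologicalSpace X]

/-- One direction is gluing. For the other, an isomorphism carries the chosen section of `P` to a
section of `P'` with the same cocycle, and the class of `P'` may be computed with any section. -/
theorem cohClass_eq_iff (P P' : PrincipalBundle G X) :
    P.cohClass = P'.cohClass ↔ P.Isomorphic P' := by
  constructor
  · exact NebulaSection.isomorphic_of_cohClass_eq
  · rintro ⟨F, hF, hact, hproj⟩
    rw [cohClass, ← P.liftableSection.cohClass_map F hF.1 hproj hact]
    exact NebulaSection.cohClass_eq _ _

theorem cohClass_surjective :
    Function.Surjective (cohClass : PrincipalBundle G X → H1 G X) := by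
  intro a
  -- A single class is represented over some family by applying the statement for two classes to the
  -- pair `a`, `a`.
  obtain ⟨Q, c, -, rfl, -⟩ := Cech.exists_of₂ (smoothSheaf G X) 1 a a
  obtain ⟨c, rfl⟩ := CechFam.mk_surjective Q _ 1 c
  refine ⟨TwistedProduct.bundle c,
    (NebulaSection.cohClass_eq _ (TwistedProduct.bundleSection c)).trans ?_⟩
  rw [NebulaSection.cohClass, TwistedProduct.transition_bundleSection]

/-- The class of the pullback bundle may be computed with the pullback of the chosen section of `P`,
taken along the tautological map from the pulled back generating family. -/
theorem cohClass_pullback {Y : Type u} [DiffeologicalSpace Y] (φ : Y → X) (hφ : DSmooth φ)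
    (P : PrincipalBundle G X) :
    (P.pullback φ hφ).cohClass = H1.pullback G φ hφ P.cohClass :=
  (NebulaSection.cohClass_eq _ _).trans
    (P.liftableSection.cohClass_pullback (FamMap.ofComap φ hφ P.liftableFam))

end PrincipalBundle

/-- The cohomology class of an isomorphism class of principal bundles. -/
def BundleClasses.cohClass {X : Type u} [DiffeologicalSpace X] : BundleClasses G X → H1 G X :=
  Quotient.lift (PrincipalBundle.cohClass : PrincipalBundle G X → H1 G X)
    fun P P' h => (P.cohClass_eq_iff P').2 h

theorem BundleClasses.cohClass_bijective (X : Type u) [DiffeologicalSpace X] :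
    Function.Bijective (BundleClasses.cohClass G : BundleClasses G X → H1 G X) := by
  constructor
  · intro a b
    refine Quotient.inductionOn₂ a b fun P P' h => ?_
    exact Quotient.sound ((P.cohClass_eq_iff P').1 h)
  · intro a
    obtain ⟨P, hP⟩ := PrincipalBundle.cohClass_surjective a
    exact ⟨Quotient.mk _ P, hP⟩

/-- The bijection between isomorphism classes of principal `G`-bundles and the first cohomology. -/
def BundleClasses.equiv (X : Type u) [DiffeologicalSpace X] : BundleClasses G X ≃ H1 G X :=
  Equiv.ofBijective (BundleClasses.cohClass G) (BundleClasses.cohClass_bijective G X)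

theorem BundleClasses.equiv_pullback {X Y : Type u} [DiffeologicalSpace X] [DiffeologicalSpace Y]
    (φ : Y → X) (hφ : DSmooth φ) (b : BundleClasses G X) :
    BundleClasses.equiv G Y (b.pullback φ hφ) = H1.pullback G φ hφ (BundleClasses.equiv G X b) :=
  Quotient.inductionOn b fun P => P.cohClass_pullback φ hφ

end Classification

end DiffCech

end

/-- For an abelian diffeological group `G` there is a bijection between the isomorphism classes of
principal `G`-bundles over `X` and `Ȟ¹(X, G)`, for all diffeological spaces `X`, that is natural with
respect to pullback along smooth maps `φ : Y → X`. -/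
theorem theoremt (G : Type v) [AddCommGroup G] [DiffeologicalSpace G]
    [DiffeologicalAddCommGroup G] :
    ∃ Ψ : ∀ (X : Type u) [DiffeologicalSpace X], BundleClasses G X ≃ H1 G X,
      ∀ (X Y : Type u) [DiffeologicalSpace X] [DiffeologicalSpace Y] (φ : Y → X) (hφ : DSmooth φ)
        (b : BundleClasses G X),
        Ψ Y (b.pullback φ hφ) = H1.pullback G φ hφ (Ψ X b) :=
  ⟨fun X _ => BundleClasses.equiv G X, fun _ _ _ _ φ hφ b =>
    BundleClasses.equiv_pullback G φ hφ b⟩
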